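/- Let $M_n=F_n/F_n^{(2)}$ be the free metabelian group of rank $n$, where $F_n$ is the free group on $a_1,\dots,a_n$ and $F_n^{(2)}=[[F_n,F_n],[F_n,F_n]]$. For every fixed $n$ and $m$, the Diophantine problem for the class $\mathcal C_m$ of spherical quadratic equations in $M_n$ with $m$ variables is in $\mathsf{P}$. That is: given words $w_1,\dots,w_m$ in the letters $a_1^{\pm1},\dots,a_n^{\pm1}$, representing elements $c_1,\dots,c_m\in M_n$, a deterministic Turing machine can decide, in time polynomial in the length of the input (that is, in $m+\sum_{j=1}^m|w_j|$), whether the equation $$z_1c_1z_1^{-1}\,z_2c_2z_2^{-1}\cdots z_mc_mz_m^{-1}=1$$ in the variables $z_1,\dots,z_m$ has a solution in $M_n$, i.e. whether there is a homomorphism $M_n*F(z_1,\dots,z_m)\to M_n$ that is the identity on $M_n$ and maps the left-hand side to $1$. The polynomial and the machine may depend on $n$ and $m$. -/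

import Mathlib

/-- The free metabelian group `M_n` of rank `n`: the quotient of the free group `F_n` by its second
derived subgroup `[F_n', F_n']`. -/
abbrev FreeMetabelianGroup (n : ℕ) : Type :=
  FreeGroup (Fin n) ⧸ derivedSeries (FreeGroup (Fin n)) 2

/-- The element of `M_n` represented by a (not necessarily reduced) word in the generators
`a_1, …, a_n` and their inverses; the letter `(i, true)` stands for the generator with index `i`
and `(i, false)` for its inverse. -/
def FreeMetabelianGroup.ofWord {n : ℕ} (w : List (Fin n × Bool)) : FreeMetabelianGroup n :=
  QuotientGroup.mk' (derivedSeries (FreeGroup (Fin n)) 2) (FreeGroup.mk w)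

/-- The equation `W = 1` in the group `G`, where `W ∈ G * F_X`, has a solution: there is a
homomorphism `G * F_X → G` which is the identity on `G` and sends `W` to `1`. -/
def EquationHasSolution {G X : Type} [Group G] (W : Monoid.Coprod G (FreeGroup X)) : Prop :=
  ∃ φ : Monoid.Coprod G (FreeGroup X) →* G,
    φ W = 1 ∧ ∀ g : G, φ (Monoid.Coprod.inl g) = g

/-- The left-hand side `z_1 c_1 z_1⁻¹ ⋯ z_m c_m z_m⁻¹` of a spherical quadratic equation of the
class `C_m`, with coefficients `c_1, …, c_m ∈ G` and variables `z_1, …, z_m`. -/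
def sphericalWord {G : Type} [Group G] {m : ℕ} (c : Fin m → G) :
    Monoid.Coprod G (FreeGroup (Fin m)) :=
  (List.ofFn fun i : Fin m =>
    Monoid.Coprod.inr (FreeGroup.of i) * Monoid.Coprod.inl (c i) *
      (Monoid.Coprod.inr (FreeGroup.of i))⁻¹).prod

/-- The string over the finite alphabet `{a_1^{±1}, …, a_n^{±1}, #}` which encodes a tuple of words
`w_1, …, w_m` as `w_1 # w_2 # … w_m #`; the separator `#` is `none`. Its length is
`|w_1| + … + |w_m| + m`. -/
def encodeWordTuple {n m : ℕ} (w : Fin m → List (Fin n × Bool)) :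
    List (Option (Fin n × Bool)) :=
  (List.ofFn fun i : Fin m => (w i).map some ++ [none]).flatten

/-- The Diophantine problem for the class `C_m` of spherical equations in `M_n`, as a language: the
set of encodings of those tuples of words `w_1, …, w_m` for which the equation
`z_1 c_1 z_1⁻¹ ⋯ z_m c_m z_m⁻¹ = 1`, where `c_i ∈ M_n` is represented by `w_i`, has a solution. -/
def sphericalDiophantineLanguage (n m : ℕ) : Language (Option (Fin n × Bool)) :=
  {x : List (Option (Fin n × Bool)) | ∃ w : Fin m → List (Fin n × Bool),
    x = encodeWordTuple w ∧
      EquationHasSolution (sphericalWord fun i => FreeMetabelianGroup.ofWord (w i))}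

open Classical in
/-- The complexity class `P`: some deterministic (multi-stack) Turing machine with finite alphabets
decides, for every string `x` over the input alphabet, whether `x ∈ L`, within a number of steps
bounded by a polynomial in the length of `x`. -/
def IsInP {A : Type} (L : Language A) : Prop :=
  ∃ M : Turing.TM2ComputableInPolyTime (fun x : List A => x) Computability.encodeBool
      (fun x : List A => decide (x ∈ L)),
    ∀ k : M.tm.K, Finite (M.tm.Γ k)

/-! Let `H ≤ ℤⁿ` be generated by the exponent vectors of the coefficients, `Q = ℤⁿ/H`, and `K` the
kernel of `F_n → Q`. Each `w_j` labels a closed path in the Cayley graph of `Q` and so has an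
integral flow on the edges; conjugating `w_j` translates this flow. The equation is solvable iff
some translates of the `m` flows add up to zero (`equationHasSolution_iff_exists_flow`). Necessity
holds because flows vanish on `[K,K]`, which contains `F_n''`. Conversely, zero flow puts a product
of conjugates of the `w_j` into `[K,K]` (`mem_commutator_of_groupFlow_eq_zero`, by a Schreier
transversal), and its image in `M_n` can be absorbed: conjugating one factor further multiplies the
product by a commutator, and since `M_n'` is abelian these commutators yield every element of
`[P,P]`, with `P` the preimage of `H` in `M_n` (`commutator_le_multipliers`).

Only small translations matter: flows whose translates overlap form clusters, and each cluster can
be moved as a whole to the origin (`exists_bounded_translations`). The sum need only be tested at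
edges traversed by the words. Two vertices agree in `Q` when their difference lies in `H`, and a
small vector of `H` is a combination of the generators with small coefficients
(`exists_bounded_coefficients`). As `m` and `n` are fixed, all search ranges are polynomial in the
input length.

All numbers that occur are thus polynomially bounded, so unary arithmetic suffices. Arithmetic,
letter lookup and bounded sums are realised by register programs (`PolyComputable`), and these
compile to Turing machines with one stack per register (`Runs.stepsTo`). -/

/-! ### Register programs and their running times -/

/-- Programs for a machine with one read-only input word, scanned by a cursor, and registers that
hold natural numbers. -/
inductive RegProgram (A : Type) : Type
  | skip : RegProgram A
  | inc (r : ℕ) : RegProgram A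
  | dec (r : ℕ) : RegProgram A
  | fwd : RegProgram A
  | bwd : RegProgram A
  | ifHead (a : A) (p : RegProgram A) : RegProgram A
  | seq (p q : RegProgram A) : RegProgram A
  | loop (r : ℕ) (p : RegProgram A) : RegProgram A
  | scan (p : RegProgram A) : RegProgram A

/-- States of the register machine: the part of the input after the cursor, the reversal of the part
before the cursor, and the contents of the registers. -/
@[ext] structure RegState (A : Type) where
  /-- the part of the input after the cursor -/
  inp : List A
  /-- the reversal of the part of the input before the cursor -/
  aux : List A
  /-- the contents of the registers -/
  reg : ℕ → ℕ

namespace RegState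

variable {A : Type}

/-- Set a register to a value. -/
def set (s : RegState A) (r v : ℕ) : RegState A :=
  ⟨s.inp, s.aux, Function.update s.reg r v⟩

@[simp] lemma set_inp (s : RegState A) (r v : ℕ) : (s.set r v).inp = s.inp := rfl
@[simp] lemma set_aux (s : RegState A) (r v : ℕ) : (s.set r v).aux = s.aux := rfl
@[simp] lemma set_reg (s : RegState A) (r v : ℕ) : (s.set r v).reg = Function.update s.reg r v := rfl

/-- Move the cursor forward, if possible. -/
def fwd (s : RegState A) : RegState A :=
  match s.inp with
  | [] => s
  | a :: l => ⟨l, a :: s.aux, s.reg⟩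

/-- Move the cursor backward, if possible. -/
def bwd (s : RegState A) : RegState A :=
  match s.aux with
  | [] => s
  | a :: l => ⟨a :: s.inp, l, s.reg⟩

end RegState

namespace RegProgram

variable {A : Type}

/-- `Runs p s t s'` says that the program `p`, started in the state `s`, halts in the state `s'` within
`t` steps. -/
inductive Runs : RegProgram A → RegState A → ℕ → RegState A → Prop
  | skip (s) : Runs skip s 1 s
  | inc (r s) : Runs (inc r) s 1 (s.set r (s.reg r + 1))
  | dec (r s) : Runs (dec r) s 1 (s.set r (s.reg r - 1))
  | fwd (s) : Runs fwd s 1 s.fwd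
  | bwd (s) : Runs bwd s 1 s.bwd
  | ifHead_pos {a p s t s'} : s.inp.head? = some a → Runs p s t s' → Runs (ifHead a p) s (1 + t) s'
  | ifHead_neg {a p s} : s.inp.head? ≠ some a → Runs (ifHead a p) s 1 s
  | seq {p q s t s' t' s''} : Runs p s t s' → Runs q s' t' s'' → Runs (seq p q) s (t + t') s''
  | loop_zero {r p s} : s.reg r = 0 → Runs (loop r p) s 1 s
  | loop_succ {r p s k t s' t' s''} : s.reg r = k + 1 → Runs p (s.set r k) t s' →
      Runs (loop r p) s' t' s'' → Runs (loop r p) s (1 + t + t') s''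
  | scan_nil {p s} : s.inp = [] → Runs (scan p) s 1 s
  | scan_cons {p s t s' t' s''} : s.inp ≠ [] → Runs p s.fwd t s' → Runs (scan p) s' t' s'' →
      Runs (scan p) s (1 + t + t') s''
  -- Times are upper bounds, so they may be rounded up to convenient polynomials.
  | mono {p s t t' s'} : Runs p s t s' → t ≤ t' → Runs p s t' s'

/-- All registers of the program are less than `N`. -/
def RegsBelow (N : ℕ) : RegProgram A → Prop
  | inc r | dec r => r < N
  | ifHead _ p | scan p => RegsBelow N p
  | seq p q => RegsBelow N p ∧ RegsBelow N q
  | loop r p => r < N ∧ RegsBelow N p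
  | _ => True

lemma RegsBelow.mono {N M : ℕ} (h : N ≤ M) : ∀ {p : RegProgram A}, RegsBelow N p → RegsBelow M p
  | .skip, _ | .fwd, _ | .bwd, _ => trivial
  | .inc _, hp | .dec _, hp => lt_of_lt_of_le hp h
  | .ifHead _ p, hp | .scan p, hp => RegsBelow.mono (p := p) h hp
  | .seq _ _, hp => ⟨hp.1.mono h, hp.2.mono h⟩
  | .loop _ _, hp => ⟨lt_of_lt_of_le hp.1 h, hp.2.mono h⟩

lemma exists_regsBelow : ∀ p : RegProgram A, ∃ N, RegsBelow N p
  | .skip | .fwd | .bwd => ⟨0, trivial⟩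
  | .inc r | .dec r => ⟨r + 1, Nat.lt_succ_self r⟩
  | .ifHead _ p | .scan p => exists_regsBelow p
  | .seq p q => by
    obtain ⟨N, hN⟩ := exists_regsBelow p
    obtain ⟨M, hM⟩ := exists_regsBelow q
    exact ⟨max N M, hN.mono (le_max_left _ _), hM.mono (le_max_right _ _)⟩
  | .loop r p => by
    obtain ⟨N, hN⟩ := exists_regsBelow p
    exact ⟨max N (r + 1), lt_of_lt_of_le (Nat.lt_succ_self r) (le_max_right _ _),
      hN.mono (le_max_left _ _)⟩

/-! ### Compilation to multi-stack Turing machines -/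

/-- The stacks: one for each register, two for the input and one for the output. -/
abbrev Stack (N : ℕ) : Type := Fin N ⊕ Bool ⊕ Unit

/-- The alphabets of the stacks. -/
abbrev StackAlphabet (A : Type) (N : ℕ) : Stack N → Type :=
  Sum.elim (fun _ => Unit) (Sum.elim (fun _ => A) fun _ => Bool)

/-- The stack of the input after the cursor. -/
abbrev inpStack (N : ℕ) : Stack N := Sum.inr (Sum.inl true)

/-- The stack of the input before the cursor. -/
abbrev auxStack (N : ℕ) : Stack N := Sum.inr (Sum.inl false)

/-- The output stack. -/
abbrev outStack (N : ℕ) : Stack N := Sum.inr (Sum.inr ())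

/-- Labels for the machine that runs the program. -/
def Label : RegProgram A → Type
  | ifHead _ p | scan p | loop _ p => Option (Label p)
  | seq p q => Label p ⊕ Label q
  | _ => Unit

instance labelFintype : ∀ p : RegProgram A, Fintype (Label p)
  | .ifHead _ p | .scan p | .loop _ p =>
    letI := labelFintype p
    inferInstanceAs (Fintype (Option (Label p)))
  | .seq p q =>
    letI := labelFintype p
    letI := labelFintype q
    inferInstanceAs (Fintype (Label p ⊕ Label q))
  | .skip | .inc _ | .dec _ | .fwd | .bwd => inferInstanceAs (Fintype Unit)

/-- The label at which the program starts. -/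
def start : ∀ p : RegProgram A, Label p
  | .ifHead _ _ | .scan _ | .loop _ _ => (none : Option _)
  | .seq p _ => Sum.inl (start p)
  | .skip | .inc _ | .dec _ | .fwd | .bwd => ()

section Compile

variable (N : ℕ)

/-- The statements of the machines used here. -/
abbrev MStmt (A : Type) (N : ℕ) (Λ : Type) : Type := Turing.TM2.Stmt (StackAlphabet A N) Λ (A × Bool)

/-- The configurations of the machines used here. -/
abbrev MCfg (A : Type) (N : ℕ) (Λ : Type) : Type := Turing.TM2.Cfg (StackAlphabet A N) Λ (A × Bool)

open Turing.TM2.Stmt in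
/-- Reset the local variables and jump. -/
def jump [Inhabited A] {Λ : Type} (l : Λ) : MStmt A N Λ := load (fun _ => default) (goto fun _ => l)

open Turing.TM2.Stmt in
/-- The code of a program inside a machine with labels `Λ`; at the end it jumps to `exit`. -/
def code [Inhabited A] [DecidableEq A] : ∀ (p : RegProgram A) {Λ : Type}, (Label p → Λ) → Λ → Label p → MStmt A N Λ
  | .skip, _, _, exit, _ => jump N exit
  | .inc r, _, _, exit, _ =>
    -- The `halt` branch is a default value, excluded by `RegsBelow N`.
    if h : r < N then push (Sum.inl ⟨r, h⟩) (fun _ => ()) (jump N exit) else halt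
  | .dec r, _, _, exit, _ =>
    if h : r < N then pop (Sum.inl ⟨r, h⟩) (fun v _ => v) (jump N exit) else halt
  | .fwd, _, _, exit, _ =>
    pop (inpStack N) (fun _ (o : Option A) => (o.getD default, o.isSome))
      (branch Prod.snd (push (auxStack N) Prod.fst (jump N exit)) (jump N exit))
  | .bwd, _, _, exit, _ =>
    pop (auxStack N) (fun _ (o : Option A) => (o.getD default, o.isSome))
      (branch Prod.snd (push (inpStack N) Prod.fst (jump N exit)) (jump N exit))
  | .ifHead a p, _, ι, exit, l =>
    match l with
    | none => peek (inpStack N) (fun v (o : Option A) => (v.1, decide (o = some a)))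
        (branch Prod.snd (jump N (ι (some (start p)))) (jump N exit))
    | some l => code p (fun l => ι (some l)) exit l
  | .seq p q, _, ι, exit, l =>
    match l with
    | Sum.inl l => code p (fun l => ι (Sum.inl l)) (ι (Sum.inr (start q))) l
    | Sum.inr l => code q (fun l => ι (Sum.inr l)) exit l
  | .loop r p, _, ι, exit, l =>
    match l with
    | none =>
      if h : r < N then
        pop (Sum.inl ⟨r, h⟩) (fun v o => (v.1, o.isSome))
          (branch Prod.snd (jump N (ι (some (start p)))) (jump N exit))
      else halt
    | some l => code p (fun l => ι (some l)) (ι none) l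
  | .scan p, _, ι, exit, l =>
    match l with
    | none =>
      pop (inpStack N) (fun _ (o : Option A) => (o.getD default, o.isSome))
        (branch Prod.snd (push (auxStack N) Prod.fst (jump N (ι (some (start p))))) (jump N exit))
    | some l => code p (fun l => ι (some l)) (ι none) l

/-- The contents of the stacks in a state of the register machine. -/
def contents (s : RegState A) : ∀ k : Stack N, List (StackAlphabet A N k)
  | Sum.inl i => List.replicate (s.reg i) ()
  | Sum.inr (Sum.inl true) => s.inp
  | Sum.inr (Sum.inl false) => s.aux
  | Sum.inr (Sum.inr _) => []

/-- The configuration that represents a state of the register machine. -/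
def toCfg [Inhabited A] {Λ : Type} (l : Λ) (s : RegState A) : MCfg A N Λ := ⟨some l, default, contents N s⟩

lemma update_contents_inl (s : RegState A) (i : Fin N) (v : ℕ) :
    Function.update (contents N s) (Sum.inl i) (List.replicate v ()) = contents N (s.set i v) := by
  funext k
  rcases k with j | (_ | _) | _
  · rcases eq_or_ne j i with rfl | h
    · rw [Function.update_self]
      simp [contents]
    · have : (j : ℕ) ≠ i := fun h' => h (Fin.ext h')
      rw [Function.update_of_ne (by simpa using h)]
      simp [contents, this]
  all_goals rfl

lemma update_contents_fwd (s : RegState A) {a : A} {l : List A} (h : s.inp = a :: l) :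
    Function.update (Function.update (contents N s) (inpStack N) l) (auxStack N) (a :: s.aux) =
      contents N s.fwd := by
  funext k
  rcases k with j | (_ | _) | _ <;> simp [contents, RegState.fwd, h, Function.update]

lemma update_contents_bwd (s : RegState A) {a : A} {l : List A} (h : s.aux = a :: l) :
    Function.update (Function.update (contents N s) (auxStack N) l) (inpStack N) (a :: s.inp) =
      contents N s.bwd := by
  funext k
  rcases k with j | (_ | _) | _ <;> simp [contents, RegState.bwd, h, Function.update]

variable {N} {Λ : Type}

/-- The machine goes from one configuration to another one in exactly `t` steps. -/
def StepsTo (M : Λ → MStmt A N Λ) (t : ℕ) (c c' : MCfg A N Λ) : Prop :=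
  (flip bind (Turing.TM2.step M))^[t] (some c) = some c'

lemma StepsTo.trans {M : Λ → MStmt A N Λ} {t t' : ℕ} {c c' c'' : MCfg A N Λ} (h : StepsTo M t c c')
    (h' : StepsTo M t' c' c'') : StepsTo M (t + t') c c'' := by
  unfold StepsTo at *
  rw [add_comm, Function.iterate_add_apply, h, h']

lemma StepsTo.single [Inhabited A] {M : Λ → MStmt A N Λ} {l : Λ} {s : RegState A} {c' : MCfg A N Λ}
    (h : Turing.TM2.stepAux (M l) default (contents N s) = c') : StepsTo M 1 (toCfg N l s) c' := by
  subst h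
  rfl

section StepAux

open Turing.TM2

variable {K Λ' σ : Type} [DecidableEq K] {Γ : K → Type} {k : K} {g : σ → Option (Γ k) → σ}
  {f : σ → Bool} {q q' : Stmt Γ Λ' σ} {v : σ} {S : ∀ k, List (Γ k)}

lemma stepAux_pop_branch_nil (h : S k = []) (hf : f (g v none) = false) :
    stepAux (Stmt.pop k g (Stmt.branch f q q')) v S = stepAux q' (g v none) S := by
  have : Function.update S k (S k).tail = S := by
    rw [Function.update_eq_self_iff, h, List.tail_nil]
  simp only [stepAux, this]
  rw [h, List.head?_nil, hf, cond_false]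

lemma stepAux_pop_branch_cons {a : Γ k} {l : List (Γ k)} (h : S k = a :: l)
    (hf : f (g v (some a)) = true) :
    stepAux (Stmt.pop k g (Stmt.branch f q q')) v S =
      stepAux q (g v (some a)) (Function.update S k l) := by
  simp only [stepAux, h, List.head?_cons, hf, cond_true, List.tail_cons]

lemma stepAux_peek_branch {o : Option (Γ k)} {b : Bool} (h : (S k).head? = o) (hf : f (g v o) = b) :
    stepAux (Stmt.peek k g (Stmt.branch f q q')) v S =
      cond b (stepAux q (g v o) S) (stepAux q' (g v o) S) := by
  subst h hf
  rfl

end StepAux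

/-- A machine whose labels contain those of a program with the corresponding code runs it. -/
theorem Runs.stepsTo [Inhabited A] [DecidableEq A] {p : RegProgram A} {s s' : RegState A} {t : ℕ}
    (h : Runs p s t s') :
    ∀ (_ : RegsBelow N p) {Λ : Type} (M : Λ → MStmt A N Λ) (ι : Label p → Λ) (exit : Λ),
      (∀ l, M (ι l) = code N p ι exit l) →
        ∃ k ≤ t, StepsTo M k (toCfg N (ι (start p)) s) (toCfg N exit s') := by
  -- `jump` resets the local variables, so whenever control passes between subprograms the
  -- configuration again has the form `toCfg`. Subprograms run inside the same machine `M`, with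
  -- their labels embedded by a restriction of `ι`.
  induction h with
  | skip s =>
    intro _ Λ M ι exit hM
    refine ⟨1, le_rfl, StepsTo.single ?_⟩
    rw [hM]
    rfl
  | inc r s =>
    intro hN Λ M ι exit hM
    replace hN : r < N := hN
    refine ⟨1, le_rfl, StepsTo.single ?_⟩
    rw [hM]
    simp only [code, hN, jump, toCfg, dite_true, Turing.TM2.stepAux]
    congr 1
    exact update_contents_inl N s ⟨r, hN⟩ (s.reg r + 1)
  | dec r s =>
    intro hN Λ M ι exit hM
    replace hN : r < N := hN
    refine ⟨1, le_rfl, StepsTo.single ?_⟩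
    rw [hM]
    simp only [code, hN, jump, toCfg, dite_true, Turing.TM2.stepAux]
    congr 1
    rw [← update_contents_inl N s ⟨r, hN⟩ (s.reg r - 1)]
    congr 1
    simp [contents]
  | fwd s =>
    intro _ Λ M ι exit hM
    refine ⟨1, le_rfl, StepsTo.single ?_⟩
    rw [hM]
    rcases hs : s.inp with _ | ⟨a, l⟩
    · have : s.fwd = s := by simp [RegState.fwd, hs]
      rw [this]
      exact stepAux_pop_branch_nil (k := inpStack N) hs rfl
    · rw [toCfg, ← update_contents_fwd N s hs]
      exact stepAux_pop_branch_cons (k := inpStack N) hs rfl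
  | bwd s =>
    intro _ Λ M ι exit hM
    refine ⟨1, le_rfl, StepsTo.single ?_⟩
    rw [hM]
    rcases hs : s.aux with _ | ⟨a, l⟩
    · have : s.bwd = s := by simp [RegState.bwd, hs]
      rw [this]
      exact stepAux_pop_branch_nil (k := auxStack N) hs rfl
    · rw [toCfg, ← update_contents_bwd N s hs]
      exact stepAux_pop_branch_cons (k := auxStack N) hs rfl
  | @ifHead_pos a p s t s' ha _ ih =>
    intro hN Λ M ι exit hM
    obtain ⟨k, hk, h⟩ := ih hN M (fun l => ι (some l)) exit (fun l => hM (some l))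
    refine ⟨1 + k, by omega, StepsTo.trans (StepsTo.single ?_) h⟩
    rw [hM]
    exact stepAux_peek_branch (k := inpStack N) (b := true) ha (by simp)
  | @ifHead_neg a p s ha =>
    intro hN Λ M ι exit hM
    refine ⟨1, le_rfl, StepsTo.single ?_⟩
    rw [hM]
    exact stepAux_peek_branch (k := inpStack N) (b := false) (o := s.inp.head?) rfl
      (decide_eq_false ha)
  | @seq p q s t s' t' s'' _ _ ih ih' =>
    intro hN Λ M ι exit hM
    obtain ⟨k, hk, h⟩ := ih hN.1 M (fun l => ι (Sum.inl l)) _ (fun l => hM (Sum.inl l))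
    obtain ⟨k', hk', h'⟩ := ih' hN.2 M (fun l => ι (Sum.inr l)) exit (fun l => hM (Sum.inr l))
    exact ⟨k + k', by omega, h.trans h'⟩
  | @loop_zero r p s h =>
    intro hN Λ M ι exit hM
    refine ⟨1, le_rfl, StepsTo.single ?_⟩
    have h' : contents N s (Sum.inl ⟨r, hN.1⟩) = [] := by simp [contents, h]
    rw [hM]
    simp only [start, code, hN.1, dite_true]
    exact stepAux_pop_branch_nil (k := (Sum.inl (⟨r, hN.1⟩ : Fin N) : Stack N)) h' rfl
  | @loop_succ r p s j t s' t' s'' hr _ _ ih ih' =>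
    intro hN Λ M ι exit hM
    obtain ⟨k, hk, h⟩ := ih hN.2 M (fun l => ι (some l)) (ι none) (fun l => hM (some l))
    obtain ⟨k', hk', h'⟩ := ih' hN M ι exit hM
    refine ⟨1 + k + k', by omega, ((StepsTo.single ?_).trans h).trans h'⟩
    have h' : contents N s (Sum.inl ⟨r, hN.1⟩) = () :: List.replicate j () := by
      simp [contents, hr, List.replicate_succ]
    rw [hM, toCfg, ← update_contents_inl N s ⟨r, hN.1⟩ j]
    simp only [start, code, hN.1, dite_true]
    exact stepAux_pop_branch_cons (k := (Sum.inl (⟨r, hN.1⟩ : Fin N) : Stack N)) h' rfl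
  | @scan_nil p s h =>
    intro hN Λ M ι exit hM
    refine ⟨1, le_rfl, StepsTo.single ?_⟩
    rw [hM]
    exact stepAux_pop_branch_nil (k := inpStack N) h rfl
  | @scan_cons p s t s' t' s'' hs _ _ ih ih' =>
    intro hN Λ M ι exit hM
    obtain ⟨k, hk, h⟩ := ih hN M (fun l => ι (some l)) (ι none) (fun l => hM (some l))
    obtain ⟨k', hk', h'⟩ := ih' hN M ι exit hM
    refine ⟨1 + k + k', by omega, ((StepsTo.single ?_).trans h).trans h'⟩
    obtain ⟨a, l, hl⟩ := List.exists_cons_of_ne_nil hs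
    rw [hM, toCfg, ← update_contents_fwd N s hl]
    exact stepAux_pop_branch_cons (k := inpStack N) hl rfl
  | mono _ ht ih =>
    intro hN Λ M ι exit hM
    obtain ⟨k, hk, h⟩ := ih hN M ι exit hM
    exact ⟨k, hk.trans ht, h⟩

end Compile

end RegProgram

/-! ### Producing the output: languages decided by register programs are in `P` -/

namespace RegProgram

variable {A : Type}

/-- Empty the input, move the content of register `0` to the output as a truth value, and halt. -/
def answer (A : Type) [Inhabited A] (N : ℕ) (Λ : Type) (l : Λ) : MStmt A (N + 1) Λ :=
  .pop (inpStack (N + 1)) (fun v o => (v.1, o.isSome)) <| .branch Prod.snd (jump (N + 1) l) <|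
    .pop (Sum.inl (0 : Fin (N + 1))) (fun v o => (v.1, o.isSome)) <| .branch Prod.snd
      (.push (outStack (N + 1)) (fun _ => true) <| .load (fun _ => default) .halt)
      (.push (outStack (N + 1)) (fun _ => false) <| .load (fun _ => default) .halt)

/-- The final configuration with a given output. -/
def haltCfg (A : Type) [Inhabited A] (N : ℕ) (Λ : Type) (b : Bool) : MCfg A N Λ :=
  ⟨none, default, Function.update (contents N ⟨[], [], 0⟩) (outStack N) [b]⟩

lemma stepsTo_answer [Inhabited A] {N : ℕ} {Λ : Type} {M : Λ → MStmt A (N + 1) Λ} {l : Λ}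
    (hM : M l = answer A N Λ l) (b : Bool) :
    ∀ x : List A, StepsTo M (x.length + 1) (toCfg (N + 1) l ⟨x, [], Function.update 0 0 b.toNat⟩)
      (haltCfg A (N + 1) Λ b)
  | [] => by
    refine StepsTo.single ?_
    rw [hM]
    refine (stepAux_pop_branch_nil (k := inpStack (N + 1)) rfl rfl).trans ?_
    cases b
    · refine (stepAux_pop_branch_nil (k := (Sum.inl (0 : Fin (N + 1)) : Stack (N + 1))) rfl rfl).trans ?_
      simp only [Turing.TM2.stepAux, haltCfg]
      congr 1
      funext k
      rcases k with j | (_ | _) | _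
      · have h : Function.update (0 : ℕ → ℕ) 0 false.toNat = 0 := Function.update_eq_self 0 (0 : ℕ → ℕ)
        rw [h]
        rfl
      all_goals rfl
    · refine (stepAux_pop_branch_cons (k := (Sum.inl (0 : Fin (N + 1)) : Stack (N + 1))) (a := ())
        (l := []) rfl rfl).trans ?_
      simp only [Turing.TM2.stepAux, haltCfg]
      congr 1
      funext k
      rcases k with j | (_ | _) | _
      · rw [Function.update_of_ne (by simp)]
        rcases eq_or_ne j 0 with rfl | h
        · rw [Function.update_self]; rfl
        · have h' : (j : ℕ) ≠ 0 := fun h' => h (Fin.ext h')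
          rw [Function.update_of_ne (fun h'' => h (Sum.inl.inj h''))]
          exact congrArg (fun n => List.replicate n ()) (Function.update_of_ne h' _ _)
      all_goals rfl
  | a :: x => by
    rw [List.length_cons, add_comm (x.length + 1) 1]
    refine StepsTo.trans (StepsTo.single ?_) (stepsTo_answer hM b x)
    rw [hM]
    refine (stepAux_pop_branch_cons (k := inpStack (N + 1)) rfl rfl).trans ?_
    simp only [jump, Turing.TM2.stepAux, toCfg]
    congr 1
    funext k
    rcases k with j | (_ | _) | _ <;> rfl

/-- The Turing machine that runs a program and answers with the content of register `0`. -/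
def machine [Inhabited A] [DecidableEq A] [Fintype A] (p : RegProgram A) (N : ℕ) : Turing.FinTM2 where
  K := Stack (N + 1)
  k₀ := inpStack (N + 1)
  k₁ := outStack (N + 1)
  Γ := StackAlphabet A (N + 1)
  Λ := Option (Label p)
  main := some (start p)
  σ := A × Bool
  initialState := default
  Γk₀Fin := inferInstanceAs (Fintype A)
  m := fun l => match l with
    | none => answer A N _ none
    | some l => code (N + 1) p some none l

open Classical in
/-- A language is in `P` if a register program decides it in polynomial time. -/
theorem isInP_of_runs [Inhabited A] [Fintype A] {L : Language A} (p : RegProgram A) (d : ℕ)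
    (h : ∀ x : List A, Runs p ⟨x, [], 0⟩ ((x.length + 2) ^ d)
      ⟨x, [], Function.update 0 0 (decide (x ∈ L)).toNat⟩) : IsInP L := by
  obtain ⟨N, hN⟩ := exists_regsBelow p
  have key : ∀ x : List A, ∃ k ≤ (x.length + 2) ^ d + (x.length + 1),
      StepsTo (machine p N).m k (toCfg (N + 1) (some (start p)) ⟨x, [], 0⟩)
        (haltCfg A (N + 1) _ (decide (x ∈ L))) := by
    intro x
    obtain ⟨k, hk, hs⟩ := (h x).stepsTo (hN.mono (Nat.le_succ N)) (machine p N).m some none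
      (fun _ => rfl)
    -- The final configuration must have every stack but the output empty: erasing the input takes
    -- `x.length` steps, and writing the answer one more.
    exact ⟨k + (x.length + 1), by omega,
      hs.trans (stepsTo_answer (M := (machine p N).m) rfl _ x)⟩
  refine ⟨⟨⟨machine p N, Equiv.refl A, Equiv.refl Bool⟩,
    (Polynomial.X + 2) ^ d + (Polynomial.X + 1), fun x => ?_⟩, ?_⟩
  · have hx := (key x).choose_spec
    have hx' : (flip bind (Turing.TM2.step (machine p N).m))^[(key x).choose] _ = _ := hx.2
    refine ⟨⟨(key x).choose, ?_⟩, ?_⟩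
    · refine Eq.trans ?_ (hx'.trans ?_)
      · congr 2
        simp only [Turing.initList, toCfg]
        congr 1
        funext k
        rcases k with j | (_ | _) | _
        · rfl
        · rfl
        · exact (dif_pos rfl).trans (List.map_id x)
        · rfl
      · simp only [haltCfg]
        congr 2
        funext k
        rcases k with j | (_ | _) | _ <;> rfl
    · simpa using hx.1
  · rintro (_ | _ | _)
    · exact inferInstanceAs (Finite Unit)
    · exact inferInstanceAs (Finite A)
    · exact inferInstanceAs (Finite Bool)

end RegProgram

namespace RegProgram

variable {A : Type}

/-! ### Polynomial-time computable functions on contexts -/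

/-- A context: a type whose elements consist of a word and some natural numbers. -/
class Context (A : outParam Type) (α : Type) where
  /-- the word -/
  word : α → List A
  /-- the numbers -/
  vars : List (α → ℕ)

instance : Context A (List A) := ⟨id, []⟩

instance {α : Type} [Context A α] : Context A (α × ℕ) :=
  ⟨fun a => Context.word a.1, Prod.snd :: (Context.vars : List (α → ℕ)).map fun f a => f a.1⟩

open Context

/-- The size of an element of a context. -/
def size {α : Type} [Context A α] (a : α) : ℕ :=
  -- The summand `2` makes powers of the size dominate constants and absorb sums.
  (word a).length + ((vars : List (α → ℕ)).map fun f => f a).sum + 2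

lemma size_prod {α : Type} [Context A α] (a : α) (i : ℕ) : size (a, i) = size a + i := by
  simp only [size, word, vars, List.map_cons, List.map_map, List.sum_cons, Function.comp_def]
  omega

lemma two_le_size {α : Type} [Context A α] (a : α) : 2 ≤ size a := by simp [size]

lemma length_lt_size {α : Type} [Context A α] (a : α) : (word a).length < size a := by
  simp only [size]; omega

/-- A function that is bounded by a polynomial in the size. -/
def PolyBounded {α : Type} [Context A α] (f : α → ℕ) : Prop := ∃ d : ℕ, ∀ a, f a ≤ size a ^ d

namespace PolyBounded

variable {α : Type} [Context A α] {f g : α → ℕ}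

lemma mono (hg : PolyBounded g) (h : ∀ a, f a ≤ g a) : PolyBounded f :=
  hg.imp fun _ hd a => (h a).trans (hd a)

lemma size : PolyBounded (size : α → ℕ) := ⟨1, fun a => by simp⟩

lemma const (k : ℕ) : PolyBounded (fun _ : α => k) :=
  ⟨k, fun a => (Nat.lt_two_pow_self.le).trans (Nat.pow_le_pow_left (two_le_size a) k)⟩

lemma mul (hf : PolyBounded f) (hg : PolyBounded g) : PolyBounded fun a => f a * g a := by
  obtain ⟨d, hd⟩ := hf
  obtain ⟨e, he⟩ := hg
  exact ⟨d + e, fun a => by rw [pow_add]; exact Nat.mul_le_mul (hd a) (he a)⟩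

lemma add (hf : PolyBounded f) (hg : PolyBounded g) : PolyBounded fun a => f a + g a := by
  obtain ⟨d, hd⟩ := hf
  obtain ⟨e, he⟩ := hg
  refine ⟨max d e + 1, fun a => ?_⟩
  have h2 := two_le_size a
  have h₁ := (hd a).trans (Nat.pow_le_pow_right (by omega) (le_max_left d e))
  have h₂ := (he a).trans (Nat.pow_le_pow_right (by omega) (le_max_right d e))
  rw [pow_succ]
  nlinarith

lemma comp_prod {h : α × ℕ → ℕ} (hh : PolyBounded h) (hf : PolyBounded f) :
    PolyBounded fun a => h (a, f a) := by
  obtain ⟨d, hd⟩ := hf.add size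
  obtain ⟨e, he⟩ := hh
  refine ⟨d * e, fun a => (he _).trans ?_⟩
  rw [size_prod, pow_mul]
  refine Nat.pow_le_pow_left ((add_comm _ _).le.trans (hd a)) e

/-- Bounds for values at all smaller arguments. -/
lemma exists_forall_lt {h : α × ℕ → ℕ} (hh : PolyBounded h) (hf : PolyBounded f) :
    ∃ B : α → ℕ, PolyBounded B ∧ ∀ a, ∀ i ≤ f a, h (a, i) ≤ B a := by
  obtain ⟨e, he⟩ := hh
  -- The size of `(a, i)` increases with `i`, so the bound at `i = f a` serves for all smaller `i`.
  -- Loops need such a uniform bound.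
  refine ⟨fun a => RegProgram.size (a, f a) ^ e,
    comp_prod (h := fun b => RegProgram.size b ^ e) ⟨e, fun _ => le_rfl⟩ hf, fun a i hi => ?_⟩
  refine (he _).trans (Nat.pow_le_pow_left ?_ e)
  rw [size_prod, size_prod]
  omega

end PolyBounded

/-- The state represents the element of the context, with the numbers in the registers `ρ`, and
all registers after `t` are empty. -/
structure Represents {α : Type} [Context A α] (ρ : List ℕ) (t : ℕ) (s : RegState A) (a : α) : Prop where
  inp : s.inp = word a
  aux : s.aux = []
  vars : List.Forall₂ (fun r (f : α → ℕ) => s.reg r = f a) ρ Context.vars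
  zero : ∀ r, t < r → s.reg r = 0

/-- A function on a context is computable in polynomial time, with unary numbers: for all
registers `ρ` for the variables and every later register `t`, some program adds
the value to the register `t`, changing nothing else. -/
def PolyComputable {α : Type} [Context A α] (f : α → ℕ) : Prop :=
  PolyBounded f ∧ ∀ (ρ : List ℕ) (t : ℕ), (∀ r ∈ ρ, r < t) →
    ∃ (p : RegProgram A) (B : α → ℕ), PolyBounded B ∧ ∀ (a : α) (s : RegState A),
      Represents ρ t s a → Runs p s (B a) (s.set t (s.reg t + f a))

/-- Loop invariant rule: `S i` is the state after `i` passes, and each pass starts with the counter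
already decremented. -/
lemma runs_loop {r : ℕ} {p : RegProgram A} {T : ℕ} (K : ℕ) (S : ℕ → RegState A)
    (hS : ∀ i ≤ K, (S i).reg r = K - i)
    (h : ∀ i < K, Runs p ((S i).set r (K - (i + 1))) T (S (i + 1))) :
    Runs (loop r p) (S 0) (K * (T + 1) + 1) (S K) := by
  induction K generalizing S with
  | zero => exact (Runs.loop_zero (by simpa using hS 0 le_rfl)).mono (by omega)
  | succ K ih =>
    have h0 := h 0 (Nat.succ_pos K)
    have h1 := ih (fun i => S (i + 1))
      (fun i hi => by rw [hS (i + 1) (by omega)]; omega)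
      (fun i hi => by
        have := h (i + 1) (by omega)
        rwa [show K + 1 - (i + 1 + 1) = K - (i + 1) by omega] at this)
    refine (Runs.loop_succ (k := K) (hS 0 (by omega)) (t := T) ?_ h1).mono
      (by rw [add_mul]; omega)
    simpa using h0

end RegProgram

open RegProgram in
/-- A language is in `P` if its indicator function is computable in polynomial time. -/
theorem isInP_of_polyComputable {A : Type} [Inhabited A] [Fintype A] {L : Language A}
    (f : List A → ℕ) (hf : PolyComputable f) (h : ∀ x, (x ∈ L → f x = 1) ∧ (x ∉ L → f x = 0)) :
    IsInP L := by
  obtain ⟨p, B, ⟨d, hd⟩, hp⟩ := hf.2 [] 0 (by simp)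
  refine isInP_of_runs p d fun x => ?_
  have := (hp x ⟨x, [], 0⟩ ⟨rfl, rfl, .nil, fun _ _ => rfl⟩).mono (hd x)
  convert this using 1
  · simp [size, Context.word, Context.vars]
  by_cases hx : x ∈ L
  · simp [RegState.set, hx, (h x).1 hx]
  · simp [RegState.set, hx, (h x).2 hx]

/-! ### Closure of polynomial-time computability under arithmetic and bounded sums -/

namespace RegProgram

variable {A : Type}

open Context

/-- Frame rule: the variables live below `t`, so changing registers from `t` on is harmless as long
as those beyond the new bound `t'` are empty. -/
lemma Represents.change {α : Type} [Context A α] {ρ : List ℕ} {t t' : ℕ} {s s' : RegState A} {a : α}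
    (h : Represents ρ t s a) (hρ : ∀ r ∈ ρ, r < t) (hi : s'.inp = s.inp) (ha : s'.aux = s.aux)
    (hr : ∀ r < t, s'.reg r = s.reg r) (hz : ∀ r, t' < r → s'.reg r = 0) :
    Represents ρ t' s' a := by
  refine ⟨hi.trans h.inp, ha.trans h.aux, ?_, hz⟩
  have hV := h.vars
  clear h
  revert hρ hV
  generalize (Context.vars : List (α → ℕ)) = V
  intro hρ hV
  induction hV with
  | nil => exact .nil
  | cons h1 _ ih =>
    rw [List.forall_mem_cons] at hρ
    exact .cons ((hr _ hρ.1).trans h1) (ih hρ.2)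

lemma runs_move {r t : ℕ} (hrt : r ≠ t) (s : RegState A) :
    Runs (loop r (inc t)) s (2 * s.reg r + 1) ((s.set r 0).set t (s.reg t + s.reg r)) := by
  have := runs_loop (r := r) (p := inc t) (T := 1) (s.reg r)
    (fun i => (s.set r (s.reg r - i)).set t (s.reg t + i))
    (fun i _ => by simp [hrt]) (fun i hi => by
      convert Runs.inc t _ using 1
      ext1 <;> try rfl
      funext x
      simp only [RegState.set_reg, Function.update_apply]
      split_ifs <;> omega)
  convert this.mono (show _ ≤ 2 * s.reg r + 1 by omega) using 1
  · ext1 <;> try rfl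
    funext x
    simp only [RegState.set_reg, Function.update_apply]
    split_ifs <;> simp_all
  · simp

lemma runs_clear (r : ℕ) (s : RegState A) :
    Runs (loop r skip) s (2 * s.reg r + 1) (s.set r 0) := by
  have := runs_loop (r := r) (p := skip) (T := 1) (s.reg r)
    (fun i => s.set r (s.reg r - i)) (fun i _ => by simp) (fun i hi => by
      convert Runs.skip _ using 1
      ext1 <;> simp)
  convert this.mono (show _ ≤ 2 * s.reg r + 1 by omega) using 1
  · ext1 <;> simp
  · simp

namespace PolyComputable

variable {α : Type} [Context A α] {f g : α → ℕ}

lemma zero : PolyComputable (fun _ : α => 0) :=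
  ⟨.const 0, fun _ t _ => ⟨skip, fun _ => 1, .const 1, fun _ s _ => by
    convert Runs.skip s using 1
    ext1 <;> simp⟩⟩

lemma one : PolyComputable (fun _ : α => 1) :=
  ⟨.const 1, fun _ t _ => ⟨inc t, fun _ => 1, .const 1, fun _ s _ => Runs.inc t s⟩⟩

lemma add (hf : PolyComputable f) (hg : PolyComputable g) : PolyComputable fun a => f a + g a := by
  refine ⟨hf.1.add hg.1, fun ρ t hρ => ?_⟩
  obtain ⟨p, B, hB, hp⟩ := hf.2 ρ t hρ
  obtain ⟨q, B', hB', hq⟩ := hg.2 ρ t hρ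
  refine ⟨p.seq q, _, hB.add hB', fun a s hs => (hp a s hs).seq ?_⟩
  convert hq a (s.set t (s.reg t + f a)) (hs.change hρ rfl rfl (fun r hr => by simp [hr.ne])
    (fun r hr => by simp [hr.ne', hs.zero r hr])) using 1
  ext1 <;> simp [add_assoc]

lemma const : ∀ k : ℕ, PolyComputable (fun _ : α => k)
  | 0 => zero
  | k + 1 => (const k).add one

lemma lift (hf : PolyComputable f) : PolyComputable fun b : α × ℕ => f b.1 := by
  have hb : ∀ {B : α → ℕ}, PolyBounded B → PolyBounded fun b : α × ℕ => B b.1 := by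
    rintro B ⟨d, hd⟩
    refine ⟨d, fun b => (hd b.1).trans (Nat.pow_le_pow_left ?_ d)⟩
    rw [← Prod.mk.eta (p := b), size_prod]
    exact Nat.le_add_right _ _
  refine ⟨hb hf.1, fun ρ t hρ => ?_⟩
  cases ρ with
  -- The context has at least one number, so no state is represented with an empty register list and
  -- any program will do.
  | nil => exact ⟨skip, _, .const 0, fun a s hs => by cases hs.vars⟩
  | cons r ρ =>
    obtain ⟨p, B, hB, hp⟩ := hf.2 ρ t fun r hr => hρ r (List.mem_cons_of_mem _ hr)
    refine ⟨p, _, hb hB, fun b s hs => hp b.1 s ⟨hs.inp, hs.aux, ?_, hs.zero⟩⟩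
    have := (List.forall₂_cons.1 hs.vars).2
    rwa [List.forall₂_map_right_iff] at this

/-- A loop destroys its counter, so the value is copied to both `t` and `t + 1`, and the second copy
is moved back. -/
lemma snd : PolyComputable fun b : α × ℕ => b.2 := by
  have hb : PolyBounded fun b : α × ℕ => b.2 := PolyBounded.size.mono fun b => by
    rw [← Prod.mk.eta (p := b), size_prod]
    exact Nat.le_add_left _ _
  refine ⟨hb, fun ρ t hρ => ?_⟩
  cases ρ with
  | nil => exact ⟨skip, _, .const 0, fun a s hs => by cases hs.vars⟩
  | cons r ρ =>
    have hr : r < t := hρ r List.mem_cons_self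
    refine ⟨(loop r ((inc t).seq (inc (t + 1)))).seq (loop (t + 1) (inc r)), _,
      (((PolyBounded.const 3).mul hb).add (.const 1)).add (((PolyBounded.const 2).mul hb).add (.const 1)),
      fun b s hs => ?_⟩
    have hv : s.reg r = b.2 := (List.forall₂_cons.1 hs.vars).1
    have hz : s.reg (t + 1) = 0 := hs.zero _ (Nat.lt_succ_self t)
    have h1 := runs_loop (r := r) (p := (inc t).seq (inc (t + 1))) (T := 1 + 1) b.2
      (fun i => ((s.set r (b.2 - i)).set t (s.reg t + i)).set (t + 1) i)
      (fun i _ => by simp [hr.ne, (hr.trans (Nat.lt_succ_self t)).ne]) (fun i hi => by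
        convert (Runs.inc t _).seq (Runs.inc (t + 1) _) using 1
        ext1 <;> try rfl
        funext x
        simp only [RegState.set_reg, Function.update_apply]
        split_ifs <;> omega)
    have h2 := runs_move (r := t + 1) (t := r) (by omega)
      (((s.set r (b.2 - b.2)).set t (s.reg t + b.2)).set (t + 1) b.2)
    convert Runs.seq (h1.mono (t' := 3 * b.2 + 1) (by omega)) (h2.mono (t' := 2 * b.2 + 1) (by simp)) using 1
    · ext1 <;> try rfl
      funext x
      simp only [RegState.set_reg, Function.update_apply]
      split_ifs <;> first | omega | simp_all
    · ext1 <;> try rfl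
      funext x
      simp only [RegState.set_reg, Function.update_apply]
      split_ifs <;> first | omega | simp_all

/-- `dec` stops at zero, so decrementing `f a` exactly `g a` times is truncated subtraction. -/
lemma tsub (hf : PolyComputable f) (hg : PolyComputable g) : PolyComputable fun a => f a - g a := by
  refine ⟨hf.1.mono fun a => Nat.sub_le _ _, fun ρ t hρ => ?_⟩
  obtain ⟨p, B, hB, hp⟩ := hf.2 ρ (t + 1) fun r hr => (hρ r hr).trans (Nat.lt_succ_self t)
  obtain ⟨q, B', hB', hq⟩ := hg.2 ρ (t + 2) fun r hr => (hρ r hr).trans (by omega)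
  refine ⟨(p.seq q).seq ((loop (t + 2) (dec (t + 1))).seq (loop (t + 1) (inc t))), _,
    (hB.add hB').add (((hg.1.mul (.const 2)).add (.const 1)).add
      (((PolyBounded.const 2).mul hf.1).add (.const 1))), fun a s hs => ?_⟩
  have hz : ∀ r, t < r → s.reg r = 0 := hs.zero
  have h1 := hp a s (hs.change hρ rfl rfl (fun _ _ => rfl) fun r hr => hz r (by omega))
  have h2 := hq a (s.set (t + 1) (s.reg (t + 1) + f a)) (hs.change hρ rfl rfl
    (fun r hr => by simp [(show r ≠ t + 1 by omega)])
    (fun r hr => by simp [(show r ≠ t + 1 by omega), hz r (by omega)]))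
  have h3 := runs_loop (r := t + 2) (p := dec (t + 1)) (T := 1) (g a)
    (fun i => (s.set (t + 1) (f a - i)).set (t + 2) (g a - i)) (fun i _ => by simp)
    (fun i hi => by
      convert Runs.dec (t + 1) _ using 1
      ext1 <;> try rfl
      funext x
      simp only [RegState.set_reg, Function.update_apply]
      split_ifs <;> omega)
  have h4 := runs_move (r := t + 1) (t := t) (by omega)
    ((s.set (t + 1) (f a - g a)).set (t + 2) (g a - g a))
  refine (h1.seq h2).seq ?_
  convert Runs.seq h3 (h4.mono (t' := 2 * f a + 1) (by simp)) using 1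
  · ext1 <;> try rfl
    funext x
    simp only [RegState.set_reg, Function.update_apply, hz (t + 1) (by omega), hz (t + 2) (by omega)]
    split_ifs <;> omega
  · ext1 <;> try rfl
    funext x
    have h1 := hz (t + 1) (by omega)
    have h2 := hz (t + 2) (by omega)
    simp only [RegState.set_reg, Function.update_apply]
    split_ifs <;> first | omega | simp_all

lemma sum {g : α → ℕ → ℕ} (hf : PolyComputable f)
    (hg : PolyComputable fun b : α × ℕ => g b.1 b.2) :
    PolyComputable fun a => ∑ i ∈ Finset.range (f a), g a i := by
  obtain ⟨G, hG, hGg⟩ := hg.1.exists_forall_lt hf.1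
  refine ⟨(hf.1.mul hG).mono fun a => ?_, fun ρ t hρ => ?_⟩
  · refine (Finset.sum_le_card_nsmul _ _ (G a) fun i hi => hGg a i (Finset.mem_range.1 hi).le).trans ?_
    simp
  obtain ⟨p, B, hB, hp⟩ := hf.2 ρ (t + 1) fun r hr => (hρ r hr).trans (Nat.lt_succ_self t)
  obtain ⟨q, B', hB', hq⟩ := hg.2 ((t + 2) :: ρ) (t + 3) (by
    rw [List.forall_mem_cons]
    exact ⟨by omega, fun r hr => (hρ r hr).trans (by omega)⟩)
  obtain ⟨T, hT, hTB⟩ := hB'.exists_forall_lt hf.1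
  -- Register `t + 1` counts down the passes, `t + 2` holds the summation index as the new variable
  -- of the context, `t + 3` receives the summand, and `t` accumulates.
  refine ⟨p.seq ((loop (t + 1) ((q.seq (loop (t + 3) (inc t))).seq (inc (t + 2)))).seq
      (loop (t + 2) skip)), _,
    hB.add (((hf.1.mul (((hT.add (((PolyBounded.const 2).mul hG).add (.const 1))).add (.const 1)).add
      (.const 1))).add (.const 1)).add (((PolyBounded.const 2).mul hf.1).add (.const 1))), fun a s hs => ?_⟩
  have hz : ∀ r, t < r → s.reg r = 0 := hs.zero
  have h1 := hp a s (hs.change hρ rfl rfl (fun _ _ => rfl) fun r hr => hz r (by omega))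
  have h2 := runs_loop (r := t + 1) (p := (q.seq (loop (t + 3) (inc t))).seq (inc (t + 2)))
    (T := T a + (2 * G a + 1) + 1) (f a)
    (fun i => ((s.set (t + 1) (f a - i)).set (t + 2) i).set t (s.reg t + ∑ j ∈ Finset.range i, g a j))
    (fun i _ => by simp) (fun i hi => by
      have e1 := hq (a, i) (((s.set (t + 1) (f a - (i + 1))).set (t + 2) i).set t
        (s.reg t + ∑ j ∈ Finset.range i, g a j)) ⟨hs.inp, hs.aux, by
          refine .cons (by simp) ?_
          rw [List.forall₂_map_right_iff]
          exact (hs.change (t' := t + 3) (s' := ((s.set (t + 1) (f a - (i + 1))).set (t + 2) i).set t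
            (s.reg t + ∑ j ∈ Finset.range i, g a j)) hρ rfl rfl (fun r hr => by
            simp [(show r ≠ t + 1 by omega), (show r ≠ t + 2 by omega), hr.ne]) (fun r hr => by
            simp [(show r ≠ t + 1 by omega), (show r ≠ t + 2 by omega), (show r ≠ t by omega),
              hz r (by omega)])).vars, fun r hr => by
            simp [(show r ≠ t + 1 by omega), (show r ≠ t + 2 by omega), (show r ≠ t by omega),
              hz r (by omega)]⟩
      have e2 := runs_move (r := t + 3) (t := t) (by omega) ((((s.set (t + 1) (f a - (i + 1))).set
        (t + 2) i).set t (s.reg t + ∑ j ∈ Finset.range i, g a j)).set (t + 3) (g a i))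
      simp only [RegState.set_reg] at e1
      convert Runs.seq (Runs.seq (e1.mono (hTB a i hi.le)) (s'' := ((((s.set (t + 1) (f a - (i + 1))).set
        (t + 2) i).set t (s.reg t + ∑ j ∈ Finset.range (i + 1), g a j))))
          (e2.mono (t' := 2 * G a + 1) (by simpa using hGg a i hi.le) |> fun h => by
            convert h using 1
            · ext1 <;> try rfl
              funext x
              have := hz (t + 3) (by omega)
              simp only [RegState.set_reg, Function.update_apply]
              split_ifs <;> omega
            · ext1 <;> try rfl
              funext x
              have := hz (t + 3) (by omega)
              rw [Finset.sum_range_succ]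
              simp only [RegState.set_reg, Function.update_apply]
              split_ifs <;> first | omega | simp_all)) (Runs.inc (t + 2) _) using 1
      · ext1 <;> try rfl
        funext x
        simp only [RegState.set_reg, Function.update_apply]
        split_ifs <;> omega
      · ext1 <;> try rfl
        funext x
        simp only [RegState.set_reg, Function.update_apply]
        split_ifs <;> omega)
  have h3 := runs_clear (t + 2) (((s.set (t + 1) (f a - f a)).set (t + 2) (f a)).set t
    (s.reg t + ∑ j ∈ Finset.range (f a), g a j))
  refine h1.seq ?_
  convert Runs.seq h2 (h3.mono (t' := 2 * f a + 1) (by simp)) using 1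
  · ext1 <;> try rfl
    funext x
    have h1 := hz (t + 1) (by omega)
    have h2 := hz (t + 2) (by omega)
    simp only [RegState.set_reg, Function.update_apply]
    split_ifs <;> first | omega | simp_all
  · ext1 <;> try rfl
    funext x
    have h1 := hz (t + 1) (by omega)
    have h2 := hz (t + 2) (by omega)
    simp only [RegState.set_reg, Function.update_apply]
    split_ifs <;> first | omega | simp_all

end PolyComputable

end RegProgram

/-! ### Reading the input word -/

namespace RegState

variable {A : Type}

/-- The state with the cursor at a given position of a word. -/
def cursor (x : List A) (k : ℕ) (f : ℕ → ℕ) : RegState A := ⟨x.drop k, (x.take k).reverse, f⟩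

lemma fwd_cursor (x : List A) (k : ℕ) (f : ℕ → ℕ) : (cursor x k f).fwd = cursor x (k + 1) f := by
  rcases lt_or_ge k x.length with h | h
  · rw [cursor, cursor, List.take_succ_eq_append_getElem h, List.drop_eq_getElem_cons h]
    simp only [RegState.fwd, List.reverse_append, List.reverse_cons, List.reverse_nil,
      List.nil_append, List.cons_append]
  · simp [cursor, RegState.fwd, List.drop_eq_nil_of_le h, List.take_of_length_le h,
      List.drop_eq_nil_of_le (h.trans (Nat.le_succ k)), List.take_of_length_le (h.trans (Nat.le_succ k))]

lemma bwd_cursor (x : List A) (k : ℕ) (f : ℕ → ℕ) (hk : k ≤ x.length) :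
    (cursor x k f).bwd = cursor x (k - 1) f := by
  rcases k with _ | k
  · rfl
  · have h : k < x.length := hk
    rw [cursor, cursor, List.take_succ_eq_append_getElem h, Nat.add_sub_cancel,
      List.drop_eq_getElem_cons h]
    simp only [RegState.bwd, List.reverse_append, List.reverse_cons, List.reverse_nil,
      List.nil_append, List.cons_append]

lemma cursor_min (x : List A) (k : ℕ) (f : ℕ → ℕ) :
    cursor x (min k x.length) f = cursor x k f := by
  rcases le_total k x.length with h | h
  · rw [min_eq_left h]
  · simp [cursor, h, List.drop_eq_nil_of_le h, List.take_of_length_le h]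

end RegState

namespace RegProgram

variable {A : Type}

open Context RegState

/-- Here `k` may exceed the length of the word: moving back at the beginning does nothing, so
superfluous moves are harmless. -/
lemma runs_rewind {r : ℕ} (x : List A) (k : ℕ) (f : ℕ → ℕ) (hf : f r = k) :
    Runs (loop r bwd) (cursor x k f) (2 * k + 1) (cursor x 0 (Function.update f r 0)) := by
  have := runs_loop (r := r) (p := bwd) (T := 1) k
    (fun i => cursor x (min k x.length - i) (Function.update f r (k - i))) (fun i _ => by simp [cursor])
    (fun i hi => by
      convert Runs.bwd _ using 1
      rw [show (cursor x (min k x.length - i) (Function.update f r (k - i))).set r (k - (i + 1)) =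
        cursor x (min k x.length - i) (Function.update f r (k - (i + 1))) by
          ext1 <;> simp [cursor], bwd_cursor _ _ _ (by omega), Nat.sub_sub])
  convert this.mono (show _ ≤ 2 * k + 1 by omega) using 1
  · rw [Nat.sub_zero, Nat.sub_zero, cursor_min, ← hf, Function.update_eq_self]
  · rw [Nat.sub_eq_zero_of_le (min_le_left _ _), Nat.sub_self]

namespace PolyComputable

variable {α : Type} [Context A α] {f g : α → ℕ}

lemma length_word : PolyComputable fun a : α => (word a).length := by
  have hb : PolyBounded fun a : α => (word a).length :=
    PolyBounded.size.mono fun a => (length_lt_size a).le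
  -- The second counter `t + 1` serves to bring the cursor back.
  refine ⟨hb, fun ρ t hρ => ⟨(scan ((inc t).seq (inc (t + 1)))).seq (loop (t + 1) bwd), _,
    ((((PolyBounded.const 3).mul hb).add (.const 1)).add
      (((PolyBounded.const 2).mul hb).add (.const 1))), fun a s hs => ?_⟩⟩
  obtain ⟨x, hx⟩ : ∃ x, word a = x := ⟨_, rfl⟩
  have h0 : s.reg (t + 1) = 0 := hs.zero _ (Nat.lt_succ_self t)
  rw [hx]
  have h1 : ∀ j k, k + j = x.length →
      Runs (scan ((inc t).seq (inc (t + 1))))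
        (cursor x k (Function.update (Function.update s.reg t (s.reg t + k)) (t + 1) k)) (3 * j + 1)
        (cursor x x.length
          (Function.update (Function.update s.reg t (s.reg t + x.length)) (t + 1) x.length)) := by
    intro j
    induction j with
    | zero =>
      rintro k rfl
      exact Runs.scan_nil (by simp [cursor])
    | succ j ih =>
      intro k hk
      refine (Runs.scan_cons (t := 1 + 1) ?_ ?_ (ih (k + 1) (by omega))).mono (by omega)
      · simp [cursor]; omega
      · rw [fwd_cursor]
        convert (Runs.inc t _).seq (Runs.inc (t + 1) _) using 1
        ext1 <;> try rfl
        funext y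
        simp only [cursor, RegState.set_reg, Function.update_apply]
        split_ifs <;> omega
  have h2 := runs_rewind (r := t + 1) x x.length
    (Function.update (Function.update s.reg t (s.reg t + x.length)) (t + 1) x.length) (by simp)
  convert (h1 x.length 0 (zero_add _)).seq h2 using 1
  · ext1
    · simp [cursor, hs.inp, hx]
    · simp [cursor, hs.aux]
    · funext y
      simp only [cursor, Function.update_apply]
      split_ifs <;> simp_all
  · ext1
    · simp [cursor, hs.inp, hx]
    · simp [cursor, hs.aux]
    · funext y
      simp only [cursor, RegState.set_reg, Function.update_apply]
      split_ifs <;> first | omega | simp_all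

lemma getElem?_word [DecidableEq A] (c : A) (hf : PolyComputable f) :
    PolyComputable fun a => if (word a)[f a]? = some c then 1 else 0 := by
  refine ⟨(PolyBounded.const 1).mono fun a => by split_ifs <;> simp, fun ρ t hρ => ?_⟩
  obtain ⟨p, B, hB, hp⟩ := hf.2 ρ (t + 1) fun r hr => (hρ r hr).trans (Nat.lt_succ_self t)
  -- `t + 1` holds the moves still to be made, `t + 2` those already made, for the way back. Past
  -- the end there is no letter to see, which matches `[k]? = none`.
  refine ⟨p.seq ((loop (t + 1) (fwd.seq (inc (t + 2)))).seq ((ifHead c (inc t)).seq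
      (loop (t + 2) bwd))), _, hB.add ((((PolyBounded.const 3).mul hf.1).add (.const 1)).add
      ((PolyBounded.const 2).add (((PolyBounded.const 2).mul hf.1).add (.const 1)))), fun a s hs => ?_⟩
  have hz : ∀ r, t < r → s.reg r = 0 := hs.zero
  obtain ⟨x, hx⟩ : ∃ x, word a = x := ⟨_, rfl⟩
  obtain ⟨k, hk⟩ : ∃ k, f a = k := ⟨_, rfl⟩
  beta_reduce
  rw [hx, hk]
  have h1 := hp a s (hs.change hρ rfl rfl (fun _ _ => rfl) fun r hr => hz r (by omega))
  rw [hk] at h1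
  have h2 := runs_loop (r := t + 1) (p := fwd.seq (inc (t + 2))) (T := 1 + 1) k
    (fun i => cursor x i (Function.update (Function.update s.reg (t + 1) (k - i)) (t + 2) i))
    (fun i _ => by simp [cursor]) (fun i hi => by
      convert (Runs.fwd _).seq (Runs.inc (t + 2) _) using 1
      rw [show (cursor x i (Function.update (Function.update s.reg (t + 1) (k - i)) (t + 2) i)).set
        (t + 1) (k - (i + 1)) = cursor x i (Function.update (Function.update s.reg (t + 1)
          (k - (i + 1))) (t + 2) i) from ?_, fwd_cursor]
      · ext1 <;> simp [cursor]
      · ext1 <;> try rfl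
        funext y
        simp only [cursor, RegState.set_reg, Function.update_apply]
        split_ifs <;> omega)
  set F := Function.update (Function.update s.reg (t + 1) (k - k)) (t + 2) k with hF
  set v := s.reg t + if x[k]? = some c then 1 else 0 with hv
  have h3 : Runs (ifHead c (inc t)) (cursor x k F) 2 (cursor x k (Function.update F t v)) := by
    have hh : (cursor x k F).inp.head? = x[k]? := by simp [cursor]
    by_cases hc : x[k]? = some c
    · convert Runs.ifHead_pos (hh.trans hc) (Runs.inc t _) using 1
      ext1 <;> simp [cursor, hv, hc, hF]
    · convert (Runs.ifHead_neg (by rw [hh]; exact hc)).mono one_le_two using 1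
      ext1 <;> simp [cursor, hv, hc, hF]
  have h4 := runs_rewind (r := t + 2) x k (Function.update F t v) (by simp [hF])
  refine h1.seq ?_
  convert h2.seq (h3.seq h4) using 1
  · ext1
    · simp [cursor, hs.inp, hx]
    · simp [cursor, hs.aux]
    · funext y
      have h1 := hz (t + 1) (by omega)
      have h2 := hz (t + 2) (by omega)
      simp only [cursor, RegState.set_reg, Function.update_apply]
      split_ifs <;> first | omega | simp_all
  · omega
  · ext1
    · simp [cursor, hs.inp, hx]
    · simp [cursor, hs.aux]
    · funext y
      have h1 := hz (t + 1) (by omega)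
      have h2 := hz (t + 2) (by omega)
      simp only [hF, cursor, RegState.set_reg, Function.update_apply]
      split_ifs <;> first | omega | simp_all

end PolyComputable

end RegProgram

/-! ### Decidable predicates, division, and integer-valued functions -/

namespace RegProgram

variable {A : Type}

open Context

namespace PolyComputable

variable {α : Type} [Context A α] {f g : α → ℕ}

lemma congr (hf : PolyComputable f) (h : ∀ a, f a = g a) : PolyComputable g := by
  rwa [← funext h]

lemma mul (hf : PolyComputable f) (hg : PolyComputable g) : PolyComputable fun a => f a * g a :=
  (hf.sum (g := fun a _ => g a) hg.lift).congr fun a => by simp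

lemma pow (hf : PolyComputable f) : ∀ k : ℕ, PolyComputable fun a => f a ^ k
  | 0 => const 1
  | k + 1 => (pow hf k).mul hf

end PolyComputable

open Classical in
/-- A predicate on a context is decidable in polynomial time, with unary numbers. -/
def PolyDecidable {α : Type} [Context A α] (P : α → Prop) : Prop :=
  PolyComputable fun a => if P a then 1 else 0

namespace PolyDecidable

variable {α : Type} [Context A α] {f g : α → ℕ} {P Q : α → Prop}

lemma indicator [DecidablePred P] (hP : PolyDecidable P) :
    PolyComputable fun a => if P a then 1 else 0 := by
  unfold PolyDecidable at hP
  convert hP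

lemma of_indicator [DecidablePred P] (hP : PolyComputable fun a => if P a then 1 else 0) :
    PolyDecidable P := by
  unfold PolyDecidable
  convert hP

lemma congr (hP : PolyDecidable P) (h : ∀ a, P a ↔ Q a) : PolyDecidable Q := by
  rwa [← funext fun a => propext (h a)]

lemma le (hf : PolyComputable f) (hg : PolyComputable g) : PolyDecidable fun a => f a ≤ g a :=
  -- With truncated subtraction, `1 - (f - g)` is the indicator of `f ≤ g`.
  ((PolyComputable.const 1).tsub (hf.tsub hg)).congr fun a => by split_ifs <;> omega

lemma lt (hf : PolyComputable f) (hg : PolyComputable g) : PolyDecidable fun a => f a < g a :=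
  le (hf.add .one) hg

lemma not (hP : PolyDecidable P) : PolyDecidable fun a => ¬ P a :=
  ((PolyComputable.const 1).tsub hP).congr fun a => by by_cases h : P a <;> simp [h]

lemma and (hP : PolyDecidable P) (hQ : PolyDecidable Q) : PolyDecidable fun a => P a ∧ Q a :=
  (PolyComputable.mul hP hQ).congr fun a => by by_cases h : P a <;> by_cases h' : Q a <;> simp [h, h']

lemma or (hP : PolyDecidable P) (hQ : PolyDecidable Q) : PolyDecidable fun a => P a ∨ Q a :=
  (hP.not.and hQ.not).not.congr fun a => by tauto

lemma imp (hP : PolyDecidable P) (hQ : PolyDecidable Q) : PolyDecidable fun a => P a → Q a :=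
  (hP.not.or hQ).congr fun a => by tauto

lemma eq (hf : PolyComputable f) (hg : PolyComputable g) : PolyDecidable fun a => f a = g a :=
  ((le hf hg).and (le hg hf)).congr fun _ => le_antisymm_iff.symm

lemma exists_lt {P : α → ℕ → Prop} (hf : PolyComputable f)
    (hP : PolyDecidable fun b : α × ℕ => P b.1 b.2) : PolyDecidable fun a => ∃ i < f a, P a i := by
  classical
  refine (lt .zero (PolyComputable.sum (g := fun a i => if P a i then 1 else 0) hf
    hP.indicator)).congr fun a => ?_
  simp [Finset.Nonempty]

lemma forall_lt {P : α → ℕ → Prop} (hf : PolyComputable f)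
    (hP : PolyDecidable fun b : α × ℕ => P b.1 b.2) : PolyDecidable fun a => ∀ i < f a, P a i :=
  (exists_lt (P := fun a i => ¬ P a i) hf hP.not).not.congr fun a => by push Not; exact Iff.rfl

lemma true : PolyDecidable fun _ : α => True := PolyComputable.one.congr fun a => by simp

lemma forall_finset {ι : Type} (s : Finset ι) {P : ι → α → Prop} (hP : ∀ i, PolyDecidable (P i)) :
    PolyDecidable fun a => ∀ i ∈ s, P i a := by
  classical
  induction s using Finset.induction_on with
  | empty => simpa using true
  | insert i s hi ih => simpa using (hP i).and ih

lemma forall_fintype {ι : Type} [Fintype ι] {P : ι → α → Prop} (hP : ∀ i, PolyDecidable (P i)) :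
    PolyDecidable fun a => ∀ i, P i a :=
  (forall_finset Finset.univ hP).congr fun a => by simp

lemma getElem?_word (c : A) (hf : PolyComputable f) :
    PolyDecidable fun a => (word a)[f a]? = some c := by
  classical
  exact of_indicator (PolyComputable.getElem?_word c hf)

end PolyDecidable

namespace PolyComputable

variable {α : Type} [Context A α] {f g : α → ℕ}

/-- The quotient counts the `i < f` with `(i + 1) * g ≤ f`; the guard `0 < g` reproduces the
convention `f / 0 = 0`. -/
lemma div (hf : PolyComputable f) (hg : PolyComputable g) : PolyComputable fun a => f a / g a := by
  classical
  refine (sum hf (g := fun a i => if 0 < g a ∧ (i + 1) * g a ≤ f a then 1 else 0) ?_).congr fun a => ?_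
  · exact ((PolyDecidable.lt .zero hg.lift).and (.le ((snd.add .one).mul hg.lift) hf.lift)).indicator
  · rw [Finset.sum_boole, Nat.cast_id]
    rcases Nat.eq_zero_or_pos (g a) with h | h
    · simp [h]
    · simp only [h, true_and, ← Nat.le_div_iff_mul_le h, Nat.succ_le_iff]
      have : (Finset.range (f a)).filter (fun i => i < f a / g a) = Finset.range (f a / g a) := by
        ext i
        have := Nat.div_le_self (f a) (g a)
        simp only [Finset.mem_filter, Finset.mem_range]
        omega
      rw [this, Finset.card_range]

lemma mod (hf : PolyComputable f) (hg : PolyComputable g) : PolyComputable fun a => f a % g a :=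
  (hf.tsub (hg.mul (hf.div hg))).congr fun a => by
    have := Nat.div_add_mod (f a) (g a)
    omega

end PolyComputable

/-- An integer-valued function that is a difference of polynomial-time computable functions. -/
def PolyComputableInt {α : Type} [Context A α] (f : α → ℤ) : Prop :=
  ∃ g h : α → ℕ, PolyComputable g ∧ PolyComputable h ∧ ∀ a, f a = g a - h a

namespace PolyComputableInt

variable {α : Type} [Context A α] {f g : α → ℤ}

lemma congr (hf : PolyComputableInt f) (h : ∀ a, f a = g a) : PolyComputableInt g := by
  rwa [← funext h]

lemma natCast {f : α → ℕ} (hf : PolyComputable f) : PolyComputableInt fun a => (f a : ℤ) :=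
  ⟨f, _, hf, .zero, fun a => by simp⟩

lemma lift (hf : PolyComputableInt f) : PolyComputableInt fun b : α × ℕ => f b.1 := by
  obtain ⟨p, q, hp, hq, h⟩ := hf
  exact ⟨_, _, hp.lift, hq.lift, fun b => h b.1⟩

lemma neg (hf : PolyComputableInt f) : PolyComputableInt fun a => -f a := by
  obtain ⟨p, q, hp, hq, h⟩ := hf
  exact ⟨q, p, hq, hp, fun a => by simp only [h]; ring⟩

lemma add (hf : PolyComputableInt f) (hg : PolyComputableInt g) :
    PolyComputableInt fun a => f a + g a := by
  obtain ⟨p, q, hp, hq, h⟩ := hf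
  obtain ⟨p', q', hp', hq', h'⟩ := hg
  exact ⟨_, _, hp.add hp', hq.add hq', fun a => by simp only [h, h']; push_cast; ring⟩

lemma sub (hf : PolyComputableInt f) (hg : PolyComputableInt g) :
    PolyComputableInt fun a => f a - g a :=
  (hf.add hg.neg).congr fun _ => (sub_eq_add_neg _ _).symm

lemma mul (hf : PolyComputableInt f) (hg : PolyComputableInt g) :
    PolyComputableInt fun a => f a * g a := by
  obtain ⟨p, q, hp, hq, h⟩ := hf
  obtain ⟨p', q', hp', hq', h'⟩ := hg
  exact ⟨_, _, (hp.mul hp').add (hq.mul hq'), (hp.mul hq').add (hq.mul hp'), fun a => by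
    simp only [h, h']; push_cast; ring⟩

lemma const : ∀ k : ℤ, PolyComputableInt fun _ : α => k
  | (k : ℕ) => natCast (.const k)
  | .negSucc k => (natCast (.const (k + 1))).neg.congr fun _ => by
    rw [Int.negSucc_eq]
    push_cast
    rfl

lemma sum {f : α → ℕ} {g : α → ℕ → ℤ} (hf : PolyComputable f)
    (hg : PolyComputableInt fun b : α × ℕ => g b.1 b.2) :
    PolyComputableInt fun a => ∑ i ∈ Finset.range (f a), g a i := by
  obtain ⟨p, q, hp, hq, h⟩ := hg
  refine ⟨_, _, hf.sum (g := fun a i => p (a, i)) hp, hf.sum (g := fun a i => q (a, i)) hq, fun a => ?_⟩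
  push_cast
  rw [← Finset.sum_sub_distrib]
  exact Finset.sum_congr rfl fun i _ => h (a, i)

lemma finset_sum {ι : Type} (s : Finset ι) {f : ι → α → ℤ} (hf : ∀ i, PolyComputableInt (f i)) :
    PolyComputableInt fun a => ∑ i ∈ s, f i a := by
  classical
  induction s using Finset.induction_on with
  | empty => simpa using const 0
  | insert i s hi ih => simpa [Finset.sum_insert hi] using (hf i).add ih

lemma ite {P : α → Prop} [DecidablePred P] (hP : PolyDecidable P) (hf : PolyComputableInt f)
    (hg : PolyComputableInt g) : PolyComputableInt fun a => if P a then f a else g a :=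
  (((natCast hP.indicator).mul hf).add ((natCast hP.not.indicator).mul hg)).congr fun a => by
    by_cases h : P a <;> simp [h]

lemma eq (hf : PolyComputableInt f) (hg : PolyComputableInt g) : PolyDecidable fun a => f a = g a := by
  obtain ⟨p, q, hp, hq, h⟩ := hf
  obtain ⟨p', q', hp', hq', h'⟩ := hg
  exact (PolyDecidable.eq (hp.add hq') (hp'.add hq)).congr fun a => by rw [h, h']; omega

end PolyComputableInt

end RegProgram

/-! ### Products of conjugates in metabelian groups -/

namespace Metabelian

open scoped commutatorElement

variable {G C : Type*} [Group G] [CommGroup C]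

/-- Conjugacy by elements of a subgroup. -/
def ConjBy (N : Subgroup G) (a b : G) : Prop := ∃ n ∈ N, n * a * n⁻¹ = b

/-- The products of the lists whose members are conjugate by elements of a subgroup to those of a
given list. -/
def IsConjProd (N : Subgroup G) (d : List G) (g : G) : Prop :=
  ∃ d', List.Forall₂ (ConjBy N) d d' ∧ d'.prod = g

variable {N : Subgroup G}

lemma ConjBy.refl (a : G) : ConjBy N a a := ⟨1, N.one_mem, by simp⟩

lemma ConjBy.trans {a b c : G} : ConjBy N a b → ConjBy N b c → ConjBy N a c := by
  rintro ⟨n, hn, rfl⟩ ⟨k, hk, rfl⟩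
  exact ⟨k * n, N.mul_mem hk hn, by group⟩

lemma conjBy_list_refl (d : List G) : List.Forall₂ (ConjBy N) d d :=
  List.forall₂_same.2 fun a _ => ConjBy.refl a

lemma conjBy_list_trans {d d' d'' : List G} (h : List.Forall₂ (ConjBy N) d d')
    (h' : List.Forall₂ (ConjBy N) d' d'') : List.Forall₂ (ConjBy N) d d'' := by
  induction h generalizing d'' with
  | nil => exact h'
  | cons h1 _ ih =>
    cases h' with
    | cons h2 h3 => exact .cons (h1.trans h2) (ih h3)

/-- The elements by which the products of lists that are conjugate to the given list can be
multiplied. -/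
def multipliers (N : Subgroup G) (d : List G) : Set G :=
  {g | ∀ d', List.Forall₂ (ConjBy N) d d' → IsConjProd N d' (g * d'.prod)}

lemma one_mem_multipliers (d : List G) : 1 ∈ multipliers N d := fun d' _ =>
  ⟨d', conjBy_list_refl d', by simp⟩

/-- The definition of `multipliers` quantifies over all lists conjugate to `d` exactly so that
multiplications can be iterated. -/
lemma mul_mem_multipliers {d : List G} {g h : G} (hg : g ∈ multipliers N d)
    (hh : h ∈ multipliers N d) : g * h ∈ multipliers N d := by
  intro d' hd
  obtain ⟨d₁, h₁, e₁⟩ := hh d' hd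
  obtain ⟨d₂, h₂, e₂⟩ := hg d₁ (conjBy_list_trans hd h₁)
  exact ⟨d₂, conjBy_list_trans h₁ h₂, by rw [e₂, e₁, mul_assoc]⟩

variable {π : G →* C}

lemma ConjBy.map_eq {a b : G} : ConjBy N a b → π a = π b := by
  rintro ⟨n, _, rfl⟩
  simp

/-- The subgroup generated by the elements of a list and the kernel of a homomorphism. -/
def preClosure (π : G →* C) (d : List G) : Subgroup G :=
  (Subgroup.closure {c | ∃ a ∈ d, π a = c}).comap π

/-- Conjugating the factor that corresponds to `a` changes the product by a commutator. Moving it to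
the front conjugates it by the prefix `l₀`, so only `π y` is prescribed. -/
lemma exists_commutator_mul_prod {d d' : List G}
    (hd : List.Forall₂ (ConjBy (preClosure π d)) d d') {a : G} (ha : a ∈ d) :
    ∃ y, π y = π a ∧ ∀ x ∈ preClosure π d, IsConjProd (preClosure π d) d' (⁅x, y⁆ * d'.prod) := by
  have key : ∀ (l₀ l l' : List G), (∀ b ∈ l, b ∈ d) → l₀.prod ∈ preClosure π d →
      List.Forall₂ (ConjBy (preClosure π d)) l l' → a ∈ l → ∃ y, π y = π a ∧
        ∀ x ∈ preClosure π d, ∃ l'', List.Forall₂ (ConjBy (preClosure π d)) l' l'' ∧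
          l₀.prod * l''.prod = ⁅x, y⁆ * (l₀.prod * l'.prod) := by
    intro l₀ l l' hl hl₀ h
    induction h generalizing l₀ with
    | nil => simp
    | @cons b b' l l' hb hll ih =>
      intro hal
      rcases eq_or_ne a b with rfl | hab
      -- With `l₀` standing for its product and `y = l₀ b' l₀⁻¹`, conjugating `b'` by `l₀⁻¹ x l₀`
      -- turns `l₀ b'` into `x y x⁻¹ l₀ = ⁅x, y⁆ l₀ b'`.
      · refine ⟨l₀.prod * b' * l₀.prod⁻¹, by simp [hb.map_eq], fun x hx => ?_⟩
        refine ⟨(l₀.prod⁻¹ * x * l₀.prod) * b' * (l₀.prod⁻¹ * x * l₀.prod)⁻¹ :: l',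
          .cons ⟨_, ?_, rfl⟩ (conjBy_list_refl l'), ?_⟩
        · exact mul_mem (mul_mem (inv_mem hl₀) hx) hl₀
        · simp only [List.prod_cons, commutatorElement_def]
          group
      · have hb' : b' ∈ preClosure π d := by
          rw [preClosure, Subgroup.mem_comap, ← hb.map_eq]
          exact Subgroup.subset_closure ⟨b, hl b List.mem_cons_self, rfl⟩
        obtain ⟨y, hy, h⟩ := ih (l₀ ++ [b']) (fun c hc => hl c (List.mem_cons_of_mem _ hc))
          (by simpa using mul_mem hl₀ hb') (by simpa [hab] using hal)
        refine ⟨y, hy, fun x hx => ?_⟩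
        obtain ⟨l'', h1, h2⟩ := h x hx
        exact ⟨b' :: l'', .cons (.refl b') h1, by simpa [mul_assoc] using h2⟩
  obtain ⟨y, hy, h⟩ := key [] d d' (fun _ h => h) (by simp) hd ha
  exact ⟨y, hy, fun x hx => by simpa [IsConjProd] using h x hx⟩

/-- Commutator identities extend the claim from `π y` a generator to `π y` in the generated
subgroup. They replace `x` by other elements over `J`, hence the quantification over all such `x`.
-/
lemma commutator_mem_multipliers_of_generators (hπ : Function.Surjective π) {d : List G}
    {J : Subgroup C}
    (hd : ∀ a ∈ d, ∀ x, π x ∈ J → ∀ y, π y = π a → ⁅x, y⁆ ∈ multipliers N d)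
    (h1 : ∀ x, π x ∈ J → ∀ y, π y = 1 → ⁅x, y⁆ ∈ multipliers N d) {x y : G} (hx : π x ∈ J)
    (hy : y ∈ preClosure π d) : ⁅x, y⁆ ∈ multipliers N d := by
  suffices h : ∀ c ∈ Subgroup.closure {c | ∃ a ∈ d, π a = c}, ∀ x, π x ∈ J → ∀ y, π y = c →
      ⁅x, y⁆ ∈ multipliers N d from h _ hy x hx y rfl
  intro c hc
  induction hc using Subgroup.closure_induction with
  | mem c hc =>
    obtain ⟨a, ha, rfl⟩ := hc
    exact hd a ha
  | one => exact h1
  | mul c c' _ _ ih ih' =>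
    intro x hx y hy
    obtain ⟨z, rfl⟩ := hπ c
    -- `⁅x, z t⁆ = ⁅x, z⁆ ⁅z x z⁻¹, z t z⁻¹⁆` with `t = z⁻¹ y`.
    have := mul_mem_multipliers (ih x hx z rfl) (ih' (z * x * z⁻¹) (by simpa using hx)
      (z * (z⁻¹ * y) * z⁻¹) (by simp [hy]))
    convert this using 1
    simp only [commutatorElement_def]
    group
  | inv c _ ih =>
    intro x hx y hy
    -- `⁅x, y⁆` is also a commutator of elements lying over `(π x)⁻¹` and `(π y)⁻¹`, so no closure
    -- of `multipliers` under inverses is needed.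
    have := ih (y * x * x⁻¹ * x⁻¹ * y⁻¹) (by simpa using J.inv_mem hx) (y * x * y⁻¹ * x⁻¹ * y⁻¹)
      (by simp [hy])
    convert this using 1
    simp only [commutatorElement_def]
    group

/-- Commutators with one entry in the kernel come first (`hA`, `hA'`); they then correct the
indeterminacy of `y` over `π a` in `exists_commutator_mul_prod` for arbitrary `x` (`hB`). -/
theorem commutator_le_multipliers (hπ : Function.Surjective π)
    (hker : ∀ x y, π x = 1 → π y = 1 → x * y = y * x) (d : List G) {g : G}
    (hg : g ∈ ⁅preClosure π d, preClosure π d⁆) : g ∈ multipliers (preClosure π d) d := by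
  have hA : ∀ {x y : G}, π x = 1 → y ∈ preClosure π d → ⁅x, y⁆ ∈ multipliers (preClosure π d) d := by
    intro x y hx hy
    refine commutator_mem_multipliers_of_generators hπ (J := ⊥) ?_ ?_ hx hy
    · intro a ha x hx y hy d' hd
      obtain ⟨z, hz, h⟩ := exists_commutator_mul_prod hd ha
      convert h x (by simp [preClosure, Subgroup.mem_bot.1 hx]) using 2
      -- For `x` in the abelian kernel, `⁅x, y⁆` depends only on `π y`, so `y` may be replaced by
      -- `z`.
      have := hker (z⁻¹ * y) x (by simp [hz, hy]) hx
      simp only [commutatorElement_def]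
      calc x * y * x⁻¹ * y⁻¹ = x * z * ((z⁻¹ * y) * x⁻¹) * y⁻¹ := by group
        _ = x * z * (x⁻¹ * (x * (z⁻¹ * y)) * x⁻¹) * y⁻¹ := by group
        _ = x * z * x⁻¹ * z⁻¹ := by rw [← this]; group
    · intro x hx y hy
      have : ⁅x, y⁆ = 1 := by rw [commutatorElement_eq_one_iff_mul_comm]; exact hker x y hx hy
      rw [this]
      exact one_mem_multipliers d
  have hA' : ∀ {x y : G}, x ∈ preClosure π d → π y = 1 → ⁅x, y⁆ ∈ multipliers (preClosure π d) d := by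
    intro x y hx hy
    have := hA (x := y⁻¹) (y := y * x * y⁻¹) (by simp [hy])
      (by simpa [preClosure, hy] using hx)
    convert this using 1
    simp only [commutatorElement_def]
    group
  have hB : ∀ {x y : G}, x ∈ preClosure π d → y ∈ preClosure π d →
      ⁅x, y⁆ ∈ multipliers (preClosure π d) d := by
    intro x y hx hy
    refine commutator_mem_multipliers_of_generators hπ (J := Subgroup.closure {c | ∃ a ∈ d, π a = c})
      ?_ (fun x hx y hy => hA' hx hy) hx hy
    intro a ha x hx y hy d' hd
    obtain ⟨z, hz, h⟩ := exists_commutator_mul_prod hd ha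
    obtain ⟨d₁, h₁, e₁⟩ := h x hx
    -- `⁅x, y⁆ = ⁅x, z⁆ ⁅z x z⁻¹, z (z⁻¹ y) z⁻¹⁆`, and the second entry of the last commutator is in
    -- the kernel. The two factors commute.
    have hm : ⁅z * x * z⁻¹, z * (z⁻¹ * y) * z⁻¹⁆ ∈ multipliers (preClosure π d) d :=
      hA' (by simpa [preClosure] using hx) (by simp [hz, hy])
    obtain ⟨d₂, h₂, e₂⟩ := hm d₁ (conjBy_list_trans hd h₁)
    refine ⟨d₂, conjBy_list_trans h₁ h₂, ?_⟩
    rw [e₂, e₁, ← mul_assoc, hker ⁅z * x * z⁻¹, z * (z⁻¹ * y) * z⁻¹⁆ ⁅x, z⁆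
      (by rw [map_commutatorElement, commutatorElement_eq_one_iff_mul_comm, mul_comm])
      (by rw [map_commutatorElement, commutatorElement_eq_one_iff_mul_comm, mul_comm])]
    congr 1
    simp only [commutatorElement_def]
    group
  rw [Subgroup.commutator_def] at hg
  -- `multipliers` is not known to be closed under inverses, so `g` and `g⁻¹` are carried through
  -- the induction together.
  suffices g ∈ multipliers (preClosure π d) d ∧ g⁻¹ ∈ multipliers (preClosure π d) d from this.1
  induction hg using Subgroup.closure_induction with
  | mem g hg =>
    obtain ⟨x, hx, y, hy, rfl⟩ := hg
    exact ⟨hB hx hy, by rw [commutatorElement_inv]; exact hB hy hx⟩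
  | one => simpa using one_mem_multipliers d
  | mul g h _ _ ih ih' =>
    exact ⟨mul_mem_multipliers ih.1 ih'.1, by rw [mul_inv_rev]; exact mul_mem_multipliers ih'.2 ih.2⟩
  | inv g _ ih => exact ⟨ih.2, by simpa using ih.1⟩

/-- In an extension of an abelian group by an abelian group: if a product of elements lies in the
derived subgroup of the subgroup that they generate together with the kernel, then some
product of conjugates of them is trivial. -/
theorem isConjProd_one (hπ : Function.Surjective π)
    (hker : ∀ x y, π x = 1 → π y = 1 → x * y = y * x) (d : List G)
    (hd : d.prod ∈ ⁅preClosure π d, preClosure π d⁆) : IsConjProd ⊤ d 1 := by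
  obtain ⟨d', h, e⟩ := commutator_le_multipliers hπ hker d (inv_mem hd) d (conjBy_list_refl d)
  exact ⟨d', h.imp fun _ _ ⟨n, _, hn⟩ => ⟨n, trivial, hn⟩, by rw [e, inv_mul_cancel]⟩

end Metabelian

/-! ### Flows of words in Cayley graphs of abelian groups -/

namespace FreeGroup

open scoped commutatorElement

variable {X Q : Type*} [AddCommGroup Q] (g : X → Q)

/-- The value of a letter in an abelian group. -/
def letterVal (l : X × Bool) : Q := if l.2 then g l.1 else -g l.1

/-- The value of a word in an abelian group. -/
def wordVal (w : List (X × Bool)) : Q := (w.map (letterVal g)).sum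

/-- The homomorphism to an abelian group with given values on the generators. -/
def valHom : FreeGroup X →* Multiplicative Q := FreeGroup.lift fun i => Multiplicative.ofAdd (g i)

/-- The edge of the Cayley graph traversed by a letter, with its sign. -/
noncomputable def letterFlow (q : Q) (l : X × Bool) : X × Q →₀ ℤ :=
  if l.2 then Finsupp.single (l.1, q) 1 else -Finsupp.single (l.1, q - g l.1) 1

/-- The flow in the Cayley graph of the path that starts at `q` and is labelled by a word. -/
noncomputable def flow : Q → List (X × Bool) → X × Q →₀ ℤ
  | _, [] => 0
  | q, l :: w => letterFlow g q l + flow (q + letterVal g l) w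

@[simp] lemma wordVal_nil : wordVal g [] = 0 := rfl

@[simp] lemma wordVal_cons (l : X × Bool) (w : List (X × Bool)) :
    wordVal g (l :: w) = letterVal g l + wordVal g w := by simp [wordVal]

@[simp] lemma wordVal_append (v w : List (X × Bool)) :
    wordVal g (v ++ w) = wordVal g v + wordVal g w := by simp [wordVal]

lemma valHom_mk (w : List (X × Bool)) : valHom g (mk w) = Multiplicative.ofAdd (wordVal g w) := by
  induction w with
  | nil => exact _root_.map_one _
  | cons l w ih =>
    rw [← List.singleton_append, ← mul_mk, _root_.map_mul, ih, wordVal_append, ofAdd_add]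
    congr 1
    rcases l with ⟨i, _ | _⟩ <;> simp [valHom, lift_mk, wordVal, letterVal]

@[simp] lemma flow_nil (q : Q) : flow g q [] = 0 := rfl

lemma flow_cons (q : Q) (l : X × Bool) (w : List (X × Bool)) :
    flow g q (l :: w) = letterFlow g q l + flow g (q + letterVal g l) w := rfl

lemma flow_append (q : Q) (v w : List (X × Bool)) :
    flow g q (v ++ w) = flow g q v + flow g (q + wordVal g v) w := by
  induction v generalizing q with
  | nil => simp
  | cons l v ih => simp [flow_cons, ih, add_assoc]

/-- A letter followed by its inverse traverses one edge in both directions, so the contributions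
cancel. -/
lemma flow_step (q : Q) {v w : List (X × Bool)} (h : Red.Step v w) : flow g q v = flow g q w := by
  obtain ⟨⟩ := h
  rename_i L₁ L₂ x b
  cases b <;> simp [flow_append, flow_cons, letterVal, letterFlow, sub_eq_add_neg]

/-- The flow of an element of the free group. -/
noncomputable def groupFlow (q : Q) : FreeGroup X → X × Q →₀ ℤ :=
  Quot.lift (flow g q) fun _ _ h => flow_step g q h

lemma groupFlow_mk (q : Q) (w : List (X × Bool)) : groupFlow g q (mk w) = flow g q w := rfl

@[simp] lemma groupFlow_one (q : Q) : groupFlow g q 1 = 0 := rfl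

lemma groupFlow_mul (q : Q) (u v : FreeGroup X) :
    groupFlow g q (u * v) = groupFlow g q u + groupFlow g (q + (valHom g u).toAdd) v := by
  obtain ⟨u, rfl⟩ := Quot.exists_rep u
  obtain ⟨v, rfl⟩ := Quot.exists_rep v
  change groupFlow g q (mk u * mk v) = groupFlow g q (mk u) +
    groupFlow g (q + (valHom g (mk u)).toAdd) (mk v)
  rw [mul_mk, groupFlow_mk, flow_append, valHom_mk]
  rfl

/-- The loop `u` returns to its start, so the paths of `z` and `z⁻¹` cancel and only the translated
loop remains. -/
lemma groupFlow_conj (q : Q) (z u : FreeGroup X) (hu : valHom g u = 1) :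
    groupFlow g q (z * u * z⁻¹) = groupFlow g (q + (valHom g z).toAdd) u := by
  have h := groupFlow_mul g q z z⁻¹
  rw [mul_inv_cancel, groupFlow_one] at h
  rw [groupFlow_mul, groupFlow_mul, _root_.map_mul, hu, mul_one, add_right_comm, ← h, zero_add]

lemma groupFlow_eq_zero_of_mem (q : Q) {u : FreeGroup X}
    (hu : u ∈ ⁅(valHom g).ker, (valHom g).ker⁆) : groupFlow g q u = 0 := by
  -- On the kernel the base point does not move, so the flow is a homomorphism to an abelian group
  -- and kills commutators.
  let φ : (valHom g).ker →* Multiplicative (X × Q →₀ ℤ) :=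
    { toFun := fun u => Multiplicative.ofAdd (groupFlow g q u)
      map_one' := rfl
      map_mul' := fun u v => by
        have : valHom g u = 1 := u.2
        rw [Subgroup.coe_mul, groupFlow_mul, this, toAdd_one, add_zero, ofAdd_add] }
  rw [← Subgroup.map_subtype_commutator] at hu
  obtain ⟨v, hv, rfl⟩ := hu
  exact Abelianization.commutator_subset_ker φ hv

section Transversal

variable {g} (τ : Q → FreeGroup X) (hτ : ∀ q, valHom g (τ q) = Multiplicative.ofAdd q)

/-- The element of the kernel obtained by closing up a path with representatives of its ends. -/
def closedPath (q : Q) (u : FreeGroup X) : (valHom g).ker :=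
  ⟨τ q * u * (τ (q + (valHom g u).toAdd))⁻¹, by simp [MonoidHom.mem_ker, hτ]⟩

lemma closedPath_mul (q : Q) (u v : FreeGroup X) : closedPath τ hτ q (u * v) =
    closedPath τ hτ q u * closedPath τ hτ (q + (valHom g u).toAdd) v := by
  ext
  simp [closedPath, add_assoc, mul_assoc]

lemma closedPath_one (q : Q) : closedPath τ hτ q 1 = 1 := by
  ext
  simp [closedPath]

/-- The homomorphism which maps an edge to the class of the corresponding closed path. -/
noncomputable def flowToAb : (X × Q →₀ ℤ) →+ Additive (Abelianization (valHom g).ker) :=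
  Finsupp.liftAddHom fun e => zmultiplesHom _
    (Additive.ofMul (Abelianization.of (closedPath τ hτ e.2 (of e.1))))

lemma flowToAb_single (e : X × Q) : flowToAb τ hτ (Finsupp.single e 1) =
    Additive.ofMul (Abelianization.of (closedPath τ hτ e.2 (of e.1))) := by
  simp [flowToAb]

/-- Along a path the representatives `τ` telescope. Hence the class of the closed-up path in the
abelianized kernel depends only on the flow. -/
lemma flowToAb_flow (q : Q) (w : List (X × Bool)) :
    flowToAb τ hτ (flow g q w) = Additive.ofMul (Abelianization.of (closedPath τ hτ q (mk w))) := by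
  induction w generalizing q with
  | nil => rw [← one_eq_mk, closedPath_one, flow_nil, map_zero, _root_.map_one, ofMul_one]
  | cons l w ih =>
    rw [flow_cons, map_add, ih, ← List.singleton_append, ← mul_mk, closedPath_mul, _root_.map_mul, ofMul_mul,
      valHom_mk]
    congr 1
    · rcases l with ⟨i, _ | _⟩
      -- The edge starts at `q - g i`; going along it and back is trivial, so the inverse letter
      -- contributes the inverse class.
      · have h := closedPath_mul τ hτ (q - g i) (of i) (of i)⁻¹
        rw [mul_inv_cancel, closedPath_one, eq_comm, mul_eq_one_iff_inv_eq] at h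
        have e : q - g i + (valHom g (of i)).toAdd = q := by simp [valHom]
        rw [e] at h
        have e' : (mk [(i, false)] : FreeGroup X) = (of i)⁻¹ := rfl
        rw [e', ← h, letterFlow, if_neg (by simp), map_neg, flowToAb_single, _root_.map_inv, ofMul_inv]
      · rw [letterFlow, if_pos rfl, flowToAb_single]
        rfl
    · simp [wordVal]

end Transversal

/-- An element of the kernel with zero flow is in the derived subgroup of the kernel. -/
theorem mem_commutator_of_groupFlow_eq_zero (hg : Function.Surjective (valHom g)) {u : FreeGroup X}
    (hu : valHom g u = 1) (h : groupFlow g 0 u = 0) : u ∈ ⁅(valHom g).ker, (valHom g).ker⁆ := by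
  choose τ hτ using fun q : Q => hg (Multiplicative.ofAdd q)
  obtain ⟨w, rfl⟩ := Quot.exists_rep u
  change valHom g (mk w) = 1 at hu
  change flow g 0 w = 0 at h
  have h1 := flowToAb_flow τ hτ 0 w
  rw [h, map_zero, eq_comm, ofMul_eq_zero, ← MonoidHom.mem_ker, Abelianization.ker_of] at h1
  have h2 : τ 0 ∈ (valHom g).ker := hτ 0
  let t : (valHom g).ker := ⟨τ 0, h2⟩
  -- The representative `τ 0` need not be `1`; conjugating by it recovers the original element.
  have h3 : t⁻¹ * closedPath τ hτ 0 (mk w) * t ∈ commutator (valHom g).ker := by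
    simpa using (inferInstance : (commutator (valHom g).ker).Normal).conj_mem _ h1 t⁻¹
  rw [← Subgroup.map_subtype_commutator]
  refine ⟨_, h3, ?_⟩
  simp only [t, closedPath, Subgroup.coe_subtype, Subgroup.coe_mul, Subgroup.coe_inv, hu, toAdd_one,
    add_zero]
  group
  rfl

end FreeGroup

/-! ### Solvability of spherical equations in terms of flows -/

section Spherical

open scoped commutatorElement

open FreeGroup

/-- By the universal properties of the coproduct and the free group, such a homomorphism amounts to
a choice of values for the variables. -/
lemma equationHasSolution_sphericalWord_iff {G : Type} [Group G] {m : ℕ} (c : Fin m → G) :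
    EquationHasSolution (sphericalWord c) ↔
      ∃ z : Fin m → G, (List.ofFn fun i => z i * c i * (z i)⁻¹).prod = 1 := by
  constructor
  · rintro ⟨φ, h, hφ⟩
    refine ⟨fun i => φ (Monoid.Coprod.inr (of i)), ?_⟩
    rw [← h, sphericalWord, map_list_prod, List.map_ofFn]
    congr 2
    funext i
    simp [hφ]
  · rintro ⟨z, h⟩
    refine ⟨Monoid.Coprod.lift (MonoidHom.id G) (FreeGroup.lift z), ?_, fun g => by simp⟩
    rw [← h, sphericalWord, map_list_prod, List.map_ofFn]
    congr 2
    funext i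
    simp

lemma forall₂_ofFn_left {α β : Type*} {R : α → β → Prop} {m : ℕ} {f : Fin m → α} {l : List β}
    (h : List.Forall₂ R (List.ofFn f) l) : ∃ f' : Fin m → β, l = List.ofFn f' ∧ ∀ i, R (f i) (f' i) := by
  induction m generalizing l with
  | zero =>
    rw [List.ofFn_zero, List.forall₂_nil_left_iff] at h
    exact ⟨Fin.elim0, by simp [h], fun i => i.elim0⟩
  | succ m ih =>
    rw [List.ofFn_succ, List.forall₂_cons_left_iff] at h
    obtain ⟨b, l', hb, hl, rfl⟩ := h
    obtain ⟨f', rfl, hf⟩ := ih hl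
    refine ⟨Fin.cons b f', by simp [List.ofFn_succ], fun i => ?_⟩
    cases i using Fin.cases with
    | zero => exact hb
    | succ i => exact hf i

variable {n m : ℕ}

/-- The exponent sum vector of a word. -/
abbrev expVec (w : List (Fin n × Bool)) : Fin n → ℤ := wordVal (fun i => Pi.single i 1) w

/-- The subgroup generated by the exponent sum vectors of a tuple of words. -/
def expSubgroup (w : Fin m → List (Fin n × Bool)) : AddSubgroup (Fin n → ℤ) :=
  AddSubgroup.closure (Set.range fun j => expVec (w j))

/-- The generators of the quotient by the subgroup generated by exponent sum vectors. -/
abbrev quotGen (w : Fin m → List (Fin n × Bool)) (i : Fin n) : (Fin n → ℤ) ⧸ expSubgroup w :=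
  QuotientAddGroup.mk (Pi.single i 1)

lemma wordVal_comp {X Q R : Type*} [AddCommGroup Q] [AddCommGroup R] (f : Q →+ R) (g : X → Q)
    (w : List (X × Bool)) : wordVal (fun i => f (g i)) w = f (wordVal g w) := by
  induction w with
  | nil => simp
  | cons l w ih => rcases l with ⟨i, _ | _⟩ <;> simp [ih, letterVal]

lemma wordVal_quotGen (w : Fin m → List (Fin n × Bool)) (v : List (Fin n × Bool)) :
    wordVal (quotGen w) v = QuotientAddGroup.mk (expVec v) :=
  wordVal_comp (QuotientAddGroup.mk' (expSubgroup w)) _ v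

lemma valHom_single_surjective :
    Function.Surjective (valHom fun i : Fin n => (Pi.single i 1 : Fin n → ℤ)) := by
  intro v
  refine ⟨(List.ofFn fun i => of i ^ v.toAdd i).prod, ?_⟩
  rw [map_list_prod, List.map_ofFn, List.prod_ofFn]
  refine Multiplicative.toAdd.injective ?_
  rw [toAdd_prod]
  conv_rhs => rw [pi_eq_sum_univ' v.toAdd]
  refine Finset.sum_congr rfl fun i _ => ?_
  simp only [Function.comp_apply, map_zpow, toAdd_zpow, valHom, lift_apply_of, toAdd_ofAdd]

lemma valHom_quotGen (w : Fin m → List (Fin n × Bool)) (u : FreeGroup (Fin n)) :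
    valHom (quotGen w) u = Multiplicative.ofAdd (QuotientAddGroup.mk
      (valHom (fun i : Fin n => (Pi.single i 1 : Fin n → ℤ)) u).toAdd) := by
  obtain ⟨v, rfl⟩ := Quot.exists_rep u
  change valHom (quotGen w) (mk v) = Multiplicative.ofAdd (QuotientAddGroup.mk
      (valHom (fun i : Fin n => (Pi.single i 1 : Fin n → ℤ)) (mk v)).toAdd)
  rw [valHom_mk, valHom_mk, wordVal_quotGen]
  rfl

lemma valHom_quotGen_surjective (w : Fin m → List (Fin n × Bool)) :
    Function.Surjective (valHom (quotGen w)) := by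
  intro q
  obtain ⟨v, hv⟩ := QuotientAddGroup.mk_surjective q.toAdd
  obtain ⟨u, hu⟩ := valHom_single_surjective (Multiplicative.ofAdd v)
  exact ⟨u, by rw [valHom_quotGen, hu, toAdd_ofAdd, hv, ofAdd_toAdd]⟩

lemma mem_commutator_of_valHom_eq_one {u : FreeGroup (Fin n)}
    (hu : valHom (fun i : Fin n => (Pi.single i 1 : Fin n → ℤ)) u = 1) :
    u ∈ commutator (FreeGroup (Fin n)) := by
  -- `ψ` recovers the class in the abelianization from the exponent vector, so a zero vector forces
  -- a trivial class.
  let ψ : (Fin n → ℤ) →+ Additive (Abelianization (FreeGroup (Fin n))) :=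
    { toFun := fun v => ∑ i, v i • Additive.ofMul (Abelianization.of (of i))
      map_zero' := by simp
      map_add' := fun v v' => by simp [add_smul, Finset.sum_add_distrib] }
  have h : ∀ u : FreeGroup (Fin n), AddMonoidHom.toMultiplicativeLeft ψ
      (valHom (fun i : Fin n => (Pi.single i 1 : Fin n → ℤ)) u) = Abelianization.of u := by
    intro u
    refine DFunLike.congr_fun (f := (AddMonoidHom.toMultiplicativeLeft ψ).comp (valHom _)) ?_ u
    ext i
    simp [ψ, valHom, Pi.single_apply]
  have h' := h u
  rw [hu, _root_.map_one, eq_comm] at h'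
  rwa [← Abelianization.ker_of]

lemma groupFlow_prod {X Q : Type*} [AddCommGroup Q] (g : X → Q) (q : Q) (l : List (FreeGroup X))
    (hl : ∀ u ∈ l, valHom g u = 1) : groupFlow g q l.prod = (l.map (groupFlow g q)).sum := by
  induction l with
  | nil => rfl
  | cons u l ih =>
    rw [List.forall_mem_cons] at hl
    rw [List.prod_cons, groupFlow_mul, hl.1, toAdd_one, add_zero, ih hl.2, List.map_cons, List.sum_cons]

lemma valHom_quotGen_mk (w : Fin m → List (Fin n × Bool)) (j : Fin m) :
    valHom (quotGen w) (mk (w j)) = 1 := by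
  rw [valHom_mk, wordVal_quotGen, ofAdd_eq_one, QuotientAddGroup.eq_zero_iff]
  exact AddSubgroup.subset_closure ⟨j, rfl⟩

lemma groupFlow_prod_conj (w : Fin m → List (Fin n × Bool)) (Z : Fin m → FreeGroup (Fin n)) :
    groupFlow (quotGen w) 0 (List.ofFn fun j => Z j * mk (w j) * (Z j)⁻¹).prod =
      ∑ j, flow (quotGen w) (valHom (quotGen w) (Z j)).toAdd (w j) := by
  rw [groupFlow_prod, List.map_ofFn, List.sum_ofFn]
  · refine Finset.sum_congr rfl fun j _ => ?_
    rw [Function.comp_apply, groupFlow_conj _ _ _ _ (valHom_quotGen_mk w j), zero_add, groupFlow_mk]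
  · simp [valHom_quotGen_mk]

/-- The quotient by the kernel is abelian, so the kernel contains `F_n'`; taking commutators gives
the claim. -/
lemma derivedSeries_two_le (w : Fin m → List (Fin n × Bool)) :
    derivedSeries (FreeGroup (Fin n)) 2 ≤ ⁅(valHom (quotGen w)).ker, (valHom (quotGen w)).ker⁆ := by
  have h : derivedSeries (FreeGroup (Fin n)) 1 ≤ (valHom (quotGen w)).ker := by
    rw [derivedSeries_one]
    exact Abelianization.commutator_subset_ker _
  exact Subgroup.commutator_mono h h

/-- The exponent sum vector of an element of the free metabelian group. -/
def FreeMetabelianGroup.expHom (n : ℕ) : FreeMetabelianGroup n →* Multiplicative (Fin n → ℤ) :=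
  QuotientGroup.lift _ (valHom fun i : Fin n => (Pi.single i 1 : Fin n → ℤ)) fun u hu =>
    Abelianization.commutator_subset_ker (valHom fun i : Fin n => (Pi.single i 1 : Fin n → ℤ))
      (by rw [← derivedSeries_one]; exact derivedSeries_antitone _ one_le_two hu)

lemma FreeMetabelianGroup.expHom_surjective : Function.Surjective (expHom n) := fun v => by
  obtain ⟨u, hu⟩ := valHom_single_surjective v
  exact ⟨QuotientGroup.mk' _ u, hu⟩

lemma FreeMetabelianGroup.mul_comm_of_expHom_eq_one (x y : FreeMetabelianGroup n)
    (hx : expHom n x = 1) (hy : expHom n y = 1) : x * y = y * x := by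
  obtain ⟨u, rfl⟩ := QuotientGroup.mk'_surjective _ x
  obtain ⟨v, rfl⟩ := QuotientGroup.mk'_surjective _ y
  rw [← commutatorElement_eq_one_iff_mul_comm, ← map_commutatorElement,
    QuotientGroup.mk'_apply, QuotientGroup.eq_one_iff]
  refine Subgroup.commutator_mem_commutator ?_ ?_
  · rw [derivedSeries_one]
    exact mem_commutator_of_valHom_eq_one hx
  · rw [derivedSeries_one]
    exact mem_commutator_of_valHom_eq_one hy

/-- A spherical equation in a free metabelian group is solvable if and only if the flows of the
coefficients in the Cayley graph of the quotient by the subgroup generated by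
their exponent sum vectors have translates with sum zero. -/
theorem equationHasSolution_iff_exists_flow (w : Fin m → List (Fin n × Bool)) :
    EquationHasSolution (sphericalWord fun i => FreeMetabelianGroup.ofWord (w i)) ↔
      ∃ δ : Fin m → (Fin n → ℤ) ⧸ expSubgroup w, ∑ j, flow (quotGen w) (δ j) (w j) = 0 := by
  rw [equationHasSolution_sphericalWord_iff]
  set p := QuotientGroup.mk' (derivedSeries (FreeGroup (Fin n)) 2) with hp
  have hmap : ∀ Z : Fin m → FreeGroup (Fin n),
      p (List.ofFn fun j => Z j * mk (w j) * (Z j)⁻¹).prod =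
        (List.ofFn fun j => p (Z j) * FreeMetabelianGroup.ofWord (w j) * (p (Z j))⁻¹).prod := by
    intro Z
    rw [map_list_prod, List.map_ofFn]
    simp only [Function.comp_def, _root_.map_mul, _root_.map_inv]
    rfl
  constructor
  · rintro ⟨z, hz⟩
    choose Z hZ using fun j => QuotientGroup.mk'_surjective _ (z j)
    obtain rfl : (fun j => p (Z j)) = z := funext hZ
    rw [← hmap, hp, QuotientGroup.mk'_apply, QuotientGroup.eq_one_iff] at hz
    refine ⟨fun j => (valHom (quotGen w) (Z j)).toAdd, ?_⟩
    rw [← groupFlow_prod_conj]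
    exact groupFlow_eq_zero_of_mem _ _ (derivedSeries_two_le w hz)
  · rintro ⟨δ, hδ⟩
    -- Conjugators lifting `δ` give a product with zero flow, that is, an element of `[K,K]`, which
    -- is in general not yet in `F_n''`.
    choose Z hZ using fun j => valHom_quotGen_surjective w (Multiplicative.ofAdd (δ j))
    have h1 := groupFlow_prod_conj w Z
    simp only [hZ, toAdd_ofAdd, hδ] at h1
    have h2 := mem_commutator_of_groupFlow_eq_zero _ (valHom_quotGen_surjective w)
      (u := (List.ofFn fun j => Z j * mk (w j) * (Z j)⁻¹).prod) (by
      rw [map_list_prod]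
      refine List.prod_eq_one ?_
      simp [valHom_quotGen_mk]) h1
    set d : List (FreeMetabelianGroup n) :=
      List.ofFn fun j => p (Z j) * FreeMetabelianGroup.ofWord (w j) * (p (Z j))⁻¹ with hd
    have hπ : ∀ j, FreeMetabelianGroup.expHom n
        (p (Z j) * FreeMetabelianGroup.ofWord (w j) * (p (Z j))⁻¹) =
          Multiplicative.ofAdd (expVec (w j)) := by
      intro j
      rw [_root_.map_mul, _root_.map_mul, _root_.map_inv, mul_right_comm, mul_inv_cancel, one_mul]
      exact valHom_mk (fun i : Fin n => (Pi.single i 1 : Fin n → ℤ)) (w j)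
    -- Conjugation preserves exponent vectors, so the factors in `d` generate `H` in `ℤⁿ` and the
    -- image of `K` lies over `H`.
    have h3 : (valHom (quotGen w)).ker.map p ≤
        Metabelian.preClosure (FreeMetabelianGroup.expHom n) d := by
      rintro _ ⟨u, hu, rfl⟩
      have hu' : valHom (quotGen w) u = 1 := hu
      rw [valHom_quotGen, ofAdd_eq_one, QuotientAddGroup.eq_zero_iff] at hu'
      have key : ∀ v ∈ expSubgroup w, Multiplicative.ofAdd v ∈
          Subgroup.closure {c | ∃ a ∈ d, FreeMetabelianGroup.expHom n a = c} := by
        intro v hv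
        induction hv using AddSubgroup.closure_induction with
        | mem v hv =>
          obtain ⟨j, rfl⟩ := hv
          exact Subgroup.subset_closure ⟨_, by rw [hd, List.mem_ofFn]; exact ⟨j, rfl⟩, hπ j⟩
        | zero => exact one_mem _
        | add v v' _ _ ih ih' => exact mul_mem ih ih'
        | neg v _ ih => exact inv_mem ih
      exact key _ hu'
    have h4 : d.prod ∈ ⁅Metabelian.preClosure (FreeMetabelianGroup.expHom n) d,
        Metabelian.preClosure (FreeMetabelianGroup.expHom n) d⁆ := by
      rw [hd, ← hmap]
      refine Subgroup.commutator_mono h3 h3 ?_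
      rw [← Subgroup.map_commutator]
      exact Subgroup.mem_map_of_mem p h2
    -- The remaining element of `[P,P]` is removed by further conjugations `k j`, which combine with
    -- `p (Z j)`.
    obtain ⟨d', hd', hprod⟩ := Metabelian.isConjProd_one FreeMetabelianGroup.expHom_surjective
      FreeMetabelianGroup.mul_comm_of_expHom_eq_one d h4
    obtain ⟨f, rfl, hf⟩ := forall₂_ofFn_left hd'
    choose k _ hk using hf
    refine ⟨fun j => k j * p (Z j), ?_⟩
    rw [← hprod]
    congr 2
    funext j
    rw [← hk]
    group

end Spherical

/-! ### Small translations -/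

section Translations

open FreeGroup

/-- If translates of some functions have sum zero, then so do translates by elements which
are bounded in terms of the supports of the functions. -/
theorem exists_bounded_translations {m : ℕ} {X Q : Type*} [AddCommGroup Q] (B : ℕ → Set Q)
    (h0 : ∀ k, 0 ∈ B k) (hmono : Monotone B) (hadd : ∀ j k, ∀ x ∈ B j, ∀ y ∈ B k, x + y ∈ B (j + k))
    (hneg : ∀ k, ∀ x ∈ B k, -x ∈ B k) (f : Fin m → X → Q → ℤ) (L : ℕ)
    (hf : ∀ j i e, f j i e ≠ 0 → e ∈ B L) (δ : Fin m → Q)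
    (hδ : ∀ i e, ∑ j, f j i (e - δ j) = 0) :
    ∃ δ' : Fin m → Q, (∀ j, δ' j ∈ B (m * (2 * L))) ∧ ∀ i e, ∑ j, f j i (e - δ' j) = 0 := by
  classical
  -- Two indices are adjacent when the translated supports meet, which forces their translations to
  -- differ by an element of `B (2 * L)`.
  let G : SimpleGraph (Fin m) :=
    { Adj := fun j k => j ≠ k ∧ ∃ i e, f j i (e - δ j) ≠ 0 ∧ f k i (e - δ k) ≠ 0
      symm := ⟨fun j k ⟨h, i, e, h1, h2⟩ => ⟨h.symm, i, e, h2, h1⟩⟩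
      loopless := ⟨fun j h => h.1 rfl⟩ }
  have hwalk : ∀ {j k : Fin m} (p : G.Walk j k), δ k - δ j ∈ B (p.length * (2 * L)) := by
    intro j k p
    induction p with
    | nil => simpa using h0 _
    | @cons a b c h p ih =>
      obtain ⟨-, i, e, h1, h2⟩ := h
      have h3 := hadd _ _ _ (hf _ _ _ h1) _ (hneg _ _ (hf _ _ _ h2))
      have h4 := hadd _ _ _ ih _ h3
      rwa [SimpleGraph.Walk.length_cons,
        show (p.length + 1) * (2 * L) = p.length * (2 * L) + (L + L) by ring,
        show δ c - δ a = δ c - δ b + (e - δ a + -(e - δ b)) by abel]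
  -- Each component is translated rigidly so that a chosen representative gets translation zero; a
  -- path in it has fewer than `m` edges.
  let r : G.ConnectedComponent → Fin m := fun c => c.out
  have hr : ∀ c, G.connectedComponentMk (r c) = c := fun c => c.out_eq
  refine ⟨fun j => δ j - δ (r (G.connectedComponentMk j)), fun j => ?_, fun i e => ?_⟩
  · have hreach : G.Reachable (r (G.connectedComponentMk j)) j :=
      SimpleGraph.ConnectedComponent.exact (hr _)
    obtain ⟨p, hp⟩ := hreach.exists_isPath
    refine hmono (Nat.mul_le_mul_right _ ?_) (hwalk p)
    simpa using hp.length_lt.le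
  -- At a given point all nonvanishing functions belong to one component, so the total sum zero
  -- splits into zero sums over the components.
  · have hcomp : ∀ (c : G.ConnectedComponent) (e : Q),
        ∑ j with G.connectedComponentMk j = c, f j i (e - δ j) = 0 := by
      intro c e
      by_cases hex : ∃ j₀, G.connectedComponentMk j₀ = c ∧ f j₀ i (e - δ j₀) ≠ 0
      · obtain ⟨j₀, rfl, h⟩ := hex
        rw [← hδ i e]
        refine Finset.sum_subset (Finset.filter_subset _ _) fun j _ hj => ?_
        by_contra hne
        refine hj (Finset.mem_filter.2 ⟨Finset.mem_univ j, ?_⟩)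
        rcases eq_or_ne j j₀ with rfl | hjj
        · rfl
        · exact SimpleGraph.ConnectedComponent.sound
            (SimpleGraph.Adj.reachable (G := G) ⟨hjj, i, e, hne, h⟩)
      · push Not at hex
        exact Finset.sum_eq_zero fun j hj => hex j (Finset.mem_filter.1 hj).2
    rw [← Finset.sum_fiberwise (s := Finset.univ) (g := fun j => G.connectedComponentMk j)]
    refine Finset.sum_eq_zero fun c _ => ?_
    rw [← hcomp c (e + δ (r c))]
    refine Finset.sum_congr rfl fun j hj => ?_
    beta_reduce
    rw [(Finset.mem_filter.1 hj).2]
    congr 1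
    abel

variable {n m : ℕ}

lemma flow_apply_add {X Q : Type*} [AddCommGroup Q] (g : X → Q) (q r : Q) (w : List (X × Bool)) (i : X)
    (e : Q) : flow g (q + r) w (i, e + r) = flow g q w (i, e) := by
  classical
  induction w generalizing q with
  | nil => rfl
  | cons l w ih =>
    rw [flow_cons, flow_cons, Finsupp.add_apply, Finsupp.add_apply, add_right_comm, ih]
    congr 1
    rcases l with ⟨k, _ | _⟩ <;>
      simp [letterFlow, Finsupp.single_apply, add_sub_right_comm]

lemma flow_apply {X Q : Type*} [AddCommGroup Q] (g : X → Q) (q : Q) (w : List (X × Bool)) (i : X)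
    (e : Q) : flow g q w (i, e) = flow g 0 w (i, e - q) := by
  rw [← flow_apply_add g 0 q, zero_add, sub_add_cancel]

/-- Every letter moves by one unit vector, so a path of length `|w|` stays in a box of that radius
around its start. -/
lemma exists_of_flow_apply_ne_zero {H : AddSubgroup (Fin n → ℤ)} (w : List (Fin n × Bool))
    (q : (Fin n → ℤ) ⧸ H) (i : Fin n) (e : (Fin n → ℤ) ⧸ H)
    (h : flow (fun i => QuotientAddGroup.mk (Pi.single i 1) : Fin n → (Fin n → ℤ) ⧸ H) q w (i, e) ≠ 0) :
    ∃ u : Fin n → ℤ, (∀ k, |u k| ≤ w.length) ∧ e = q + QuotientAddGroup.mk u := by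
  classical
  have hs : ∀ i k : Fin n, |(Pi.single i 1 : Fin n → ℤ) k| ≤ 1 := fun i k => by
    rw [Pi.single_apply]
    split_ifs <;> simp
  induction w generalizing q with
  | nil => simp at h
  | cons l w ih =>
    rw [flow_cons, Finsupp.add_apply] at h
    by_cases h1 : letterFlow (fun i => QuotientAddGroup.mk (Pi.single i 1) :
        Fin n → (Fin n → ℤ) ⧸ H) q l (i, e) = 0
    · rw [h1, zero_add] at h
      obtain ⟨u, hu, rfl⟩ := ih _ h
      rcases l with ⟨k, _ | _⟩
      · refine ⟨-Pi.single k 1 + u, fun j => ?_, ?_⟩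
        · have := abs_add_le (-(Pi.single k 1 : Fin n → ℤ) j) (u j)
          rw [abs_neg] at this
          have h1 := hs k j
          have h2 := hu j
          simp only [Pi.add_apply, Pi.neg_apply, List.length_cons]
          push_cast
          linarith
        · simp [letterVal, add_assoc]
      · refine ⟨Pi.single k 1 + u, fun j => ?_, ?_⟩
        · have := abs_add_le ((Pi.single k 1 : Fin n → ℤ) j) (u j)
          have h1 := hs k j
          have h2 := hu j
          simp only [Pi.add_apply, List.length_cons]
          push_cast
          linarith
        · simp [letterVal, add_assoc]
    · rcases l with ⟨k, _ | _⟩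
      · refine ⟨-Pi.single k 1, fun j => ?_, ?_⟩
        · have h1 := hs k j
          simp only [Pi.neg_apply, abs_neg, List.length_cons]
          push_cast
          linarith
        · have : (k, q - (QuotientAddGroup.mk (Pi.single k 1) : (Fin n → ℤ) ⧸ H)) = (i, e) := by
            by_contra hne
            simp [letterFlow, hne] at h1
          rw [← (Prod.mk.inj this).2]
          simp [sub_eq_add_neg]
      · refine ⟨0, fun j => by simp; positivity, ?_⟩
        have : (k, q) = (i, e) := by
          by_contra hne
          simp [letterFlow, hne] at h1
        rw [← (Prod.mk.inj this).2]
        simp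

/-- The translations can be taken from a box. -/
theorem exists_flow_iff_exists_bounded (w : Fin m → List (Fin n × Bool)) (L : ℕ)
    (hL : ∀ j, (w j).length ≤ L) :
    (∃ δ : Fin m → (Fin n → ℤ) ⧸ expSubgroup w, ∑ j, flow (quotGen w) (δ j) (w j) = 0) ↔
      ∃ v : Fin m → Fin n → ℕ, (∀ j k, v j k ≤ 2 * (m * (2 * L))) ∧
        ∑ j, flow (quotGen w) (QuotientAddGroup.mk fun k => (v j k : ℤ)) (w j) = 0 := by
  constructor
  · rintro ⟨δ, hδ⟩
    obtain ⟨δ', hB, h⟩ := exists_bounded_translations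
      (fun k => {e : (Fin n → ℤ) ⧸ expSubgroup w |
        ∃ u : Fin n → ℤ, (∀ i, |u i| ≤ k) ∧ e = QuotientAddGroup.mk u})
      (fun k => ⟨0, by simp, rfl⟩)
      (fun j k hjk e ⟨u, hu, he⟩ => ⟨u, fun i => (hu i).trans (by exact_mod_cast hjk), he⟩)
      (by
        rintro j k _ ⟨u, hu, rfl⟩ _ ⟨u', hu', rfl⟩
        exact ⟨u + u', fun i => (abs_add_le _ _).trans (by push_cast; exact add_le_add (hu i) (hu' i)), rfl⟩)
      (by
        rintro k _ ⟨u, hu, rfl⟩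
        exact ⟨-u, fun i => by simpa using hu i, rfl⟩)
      (fun j i e => flow (quotGen w) 0 (w j) (i, e)) L
      (fun j i e he => by
        obtain ⟨u, hu, h⟩ := exists_of_flow_apply_ne_zero _ _ _ _ he
        exact ⟨u, fun k => (hu k).trans (by exact_mod_cast hL j), by rw [h, zero_add]⟩)
      δ (fun i e => by
        have := DFunLike.congr_fun hδ (i, e)
        rw [Finsupp.finsetSum_apply, Finsupp.zero_apply] at this
        simpa only [flow_apply _ (δ _)] using this)
    choose u hu he using hB
    -- A common shift of all translations preserves the vanishing of the sum and makes the
    -- coordinates nonnegative.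
    refine ⟨fun j k => (u j k + (m * (2 * L) : ℕ)).toNat, fun j k => ?_, ?_⟩
    · have := abs_le.1 (hu j k)
      beta_reduce
      generalize m * (2 * L) = K at this ⊢
      omega
    · ext ⟨i, e⟩
      rw [Finsupp.finsetSum_apply, Finsupp.zero_apply,
        ← h i (e - QuotientAddGroup.mk fun _ => ((m * (2 * L) : ℕ) : ℤ))]
      refine Finset.sum_congr rfl fun j _ => ?_
      rw [flow_apply, he, sub_sub, ← QuotientAddGroup.mk_add]
      congr 4
      funext k
      have := abs_le.1 (hu j k)
      simp only [Pi.add_apply]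
      omega
  · rintro ⟨v, _, h⟩
    exact ⟨_, h⟩

end Translations

/-! ### Small integral coefficients -/

section Coefficients

lemma abs_sum_mul_le {m : ℕ} {a b : Fin m → ℤ} {A B : ℤ} (ha : ∀ j, |a j| ≤ A) (hb : ∀ j, |b j| ≤ B)
    (hA : 0 ≤ A) : |∑ j, a j * b j| ≤ m * (A * B) := by
  refine (Finset.abs_sum_le_sum_abs _ _).trans ?_
  refine (Finset.sum_le_card_nsmul _ _ (A * B) fun j _ => ?_).trans (by simp)
  rw [abs_mul]
  exact mul_le_mul (ha j) (hb j) (abs_nonneg _) hA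

/-- An integral linear combination of small vectors that is small is one with small coefficients. -/
theorem exists_bounded_coefficients (n m : ℕ) : ∃ d : ℕ, ∀ L : ℤ, 2 ≤ L →
    ∀ (c : Fin m → Fin n → ℤ) (y : Fin n → ℤ), (∀ j i, |c j i| ≤ L) → (∀ i, |y i| ≤ L) →
      (∃ k : Fin m → ℤ, ∀ i, y i = ∑ j, k j * c j i) →
        ∃ k : Fin m → ℤ, (∀ j, |k j| ≤ L ^ d) ∧ ∀ i, y i = ∑ j, k j * c j i := by
  induction n with
  | zero => exact ⟨0, fun L _ c y _ _ _ => ⟨0, by simp, fun i => i.elim0⟩⟩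
  | succ n ih =>
    obtain ⟨d, hd⟩ := ih
    -- The induction hypothesis is applied with `L ^ (m + 5)` in place of `L`; the remaining `m + 5`
    -- pays for recombining the coefficients.
    refine ⟨(m + 5) * d + m + 5, fun L hL c y hc hy ⟨k, hk⟩ => ?_⟩
    have hL1 : 1 ≤ L := by omega
    have hpow : ∀ {a b : ℕ}, a ≤ b → L ^ a ≤ L ^ b := fun h => pow_le_pow_right₀ hL1 h
    have hm : (m : ℤ) ≤ L ^ m := by
      calc (m : ℤ) ≤ 2 ^ m := by exact_mod_cast Nat.lt_two_pow_self.le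
        _ ≤ L ^ m := pow_le_pow_left₀ (by norm_num) hL m
    by_cases hp : ∃ p, c p 0 ≠ 0
    · obtain ⟨p, hp⟩ := hp
      set a := c p 0 with ha
      have haL : |a| ≤ L := hc p 0
      -- The remainders modulo the pivot `a` are already small; only the quotients `q` have to be
      -- replaced.
      set r : Fin m → ℤ := fun j => k j % a with hr
      set q : Fin m → ℤ := fun j => k j / a with hq
      have hkqr : ∀ j, k j = a * q j + r j := fun j => (Int.mul_ediv_add_emod (k j) a).symm
      have hr' : ∀ j, |r j| ≤ L := fun j => by
        rw [abs_of_nonneg (Int.emod_nonneg _ hp)]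
        exact (Int.emod_lt_abs _ hp).le.trans haL
      set K := ∑ j, q j * c j 0 with hK
      have hrc : ∀ i, |∑ j, r j * c j i| ≤ L ^ (m + 2) := fun i => by
        refine (abs_sum_mul_le hr' (fun j => hc j i) (by omega)).trans ?_
        rw [pow_add, pow_two]
        exact mul_le_mul_of_nonneg_right hm (by positivity)
      have hyr : ∀ i, |y i - ∑ j, r j * c j i| ≤ L ^ (m + 3) := fun i => by
        refine (abs_sub _ _).trans ?_
        have h1 : L ≤ L ^ (m + 2) := le_self_pow₀ hL1 (by omega)
        have h2 := hrc i
        have h3 := hy i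
        rw [pow_succ]
        nlinarith [pow_pos (show 0 < L by omega) (m + 2)]
      have hKa : y 0 - ∑ j, r j * c j 0 = K * a := by
        rw [hk 0, hK, Finset.sum_mul, ← Finset.sum_sub_distrib]
        refine Finset.sum_congr rfl fun j _ => ?_
        rw [hkqr j]
        ring
      have hKL : |K| ≤ L ^ (m + 3) := by
        refine le_trans ?_ (hKa ▸ hyr 0)
        rw [abs_mul]
        exact le_mul_of_one_le_right (abs_nonneg K) (Int.one_le_abs hp)
      -- Elimination with the pivot: `a c_j - c_{j0} c_p` has first coordinate zero, and the
      -- original `q` expresses `z` through these vectors.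
      set c' : Fin m → Fin n → ℤ := fun j i => a * c j i.succ - c j 0 * c p i.succ with hc'
      set z : Fin n → ℤ := fun i => y i.succ - ∑ j, r j * c j i.succ - K * c p i.succ with hz
      obtain ⟨q', hq', hq'z⟩ := hd (L ^ (m + 5)) (hL.trans (le_self_pow₀ hL1 (by omega))) c' z
        (fun j i => by
          have h1 : |a * c j i.succ| ≤ L * L := by
            rw [abs_mul]; exact mul_le_mul haL (hc _ _) (abs_nonneg _) (by omega)
          have h2 : |c j 0 * c p i.succ| ≤ L * L := by
            rw [abs_mul]; exact mul_le_mul (hc _ _) (hc _ _) (abs_nonneg _) (by omega)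
          have h3 : |c' j i| ≤ _ := abs_sub (a * c j i.succ) (c j 0 * c p i.succ)
          have h4 : L ^ 3 ≤ L ^ (m + 5) := hpow (by omega)
          nlinarith)
        (fun i => by
          have h1 : |K * c p i.succ| ≤ L ^ (m + 3) * L := by
            rw [abs_mul]; exact mul_le_mul hKL (hc _ _) (abs_nonneg _) (by positivity)
          have h2 : |z i| ≤ _ := abs_sub (y i.succ - ∑ j, r j * c j i.succ) (K * c p i.succ)
          have h3 := hyr i.succ
          have h4 : L ^ (m + 5) = L ^ (m + 3) * L * L := by ring
          have h5 := pow_pos (show 0 < L by omega) (m + 3)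
          have h6 : L ^ (m + 3) * (1 + L) ≤ L ^ (m + 3) * (L * L) :=
            mul_le_mul_of_nonneg_left (by nlinarith) h5.le
          nlinarith)
        ⟨q, fun i => by
          simp only [hz, hc', hK, hk i.succ, Finset.sum_mul]
          rw [← Finset.sum_sub_distrib, ← Finset.sum_sub_distrib]
          refine Finset.sum_congr rfl fun j _ => ?_
          rw [hkqr j]
          ring⟩
      have hsum : ∀ i, ∑ j, (a * q' j + r j + if j = p then K - ∑ i, q' i * c i 0 else 0) * c j i =
          ∑ j, q' j * (a * c j i - c j 0 * c p i) + ∑ j, r j * c j i + K * c p i := by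
        intro i
        simp only [add_mul, ite_mul, zero_mul, Finset.sum_add_distrib, Finset.sum_ite_eq',
          Finset.mem_univ, if_true, mul_sub, Finset.sum_sub_distrib, sub_mul, Finset.sum_mul]
        rw [Finset.sum_congr rfl fun j _ => show a * q' j * c j i = q' j * (a * c j i) by ring,
          Finset.sum_congr rfl fun j _ => show q' j * c j 0 * c p i = q' j * (c j 0 * c p i) by ring]
        ring
      -- The correction at `p` collects the multiples of `c p` split off by the elimination; `K` is
      -- small because `K * a` is.
      refine ⟨fun j => a * q' j + r j + if j = p then K - ∑ i, q' i * c i 0 else 0, fun j => ?_,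
        fun i => ?_⟩
      · set D := (m + 5) * d with hD
        have hq'' : ∀ j, |q' j| ≤ L ^ D := fun j => by rw [hD, pow_mul]; exact hq' j
        have hDpos : 0 < L ^ D := by positivity
        have h1 : |a * q' j| ≤ L ^ (D + m + 3) := by
          rw [abs_mul]
          refine (mul_le_mul haL (hq'' j) (abs_nonneg _) (by omega)).trans ?_
          rw [← pow_succ']
          exact hpow (by omega)
        have h2 : |r j| ≤ L ^ (D + m + 3) := (hr' j).trans (le_self_pow₀ hL1 (by omega))
        have h3 : |K| ≤ L ^ (D + m + 3) := hKL.trans (hpow (by omega))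
        have h4 : |∑ i, q' i * c i 0| ≤ L ^ (D + m + 3) := by
          refine (abs_sum_mul_le hq'' (fun j => hc j 0) hDpos.le).trans ?_
          refine (mul_le_mul_of_nonneg_right hm (by positivity)).trans ?_
          rw [← pow_succ, ← pow_add]
          exact hpow (by omega)
        have h5 : |if j = p then K - ∑ i, q' i * c i 0 else 0| ≤ 2 * L ^ (D + m + 3) := by
          split_ifs
          · exact (abs_sub _ _).trans (by linarith)
          · simp; positivity
        have h6 := abs_add_three (a * q' j) (r j) (if j = p then K - ∑ i, q' i * c i 0 else 0)
        have h7 : L ^ (D + m + 5) = L ^ (D + m + 3) * (L * L) := by ring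
        have h8 : L ^ (D + m + 3) * 4 ≤ L ^ (D + m + 3) * (L * L) :=
          mul_le_mul_of_nonneg_left (by nlinarith) (by positivity)
        linarith
      · rw [hsum]
        refine Fin.cases ?_ (fun i => ?_) i
        · rw [Finset.sum_eq_zero fun j _ => by rw [← ha]; ring, ← ha]
          linarith
        · have := hq'z i
          simp only [hz, hc'] at this
          linarith
    · push Not at hp
      obtain ⟨k', hk', h⟩ := hd L hL (fun j i => c j i.succ) (fun i => y i.succ)
        (fun j i => hc j i.succ) (fun i => hy i.succ) ⟨k, fun i => hk i.succ⟩
      refine ⟨k', fun j => (hk' j).trans (hpow ?_), fun i => ?_⟩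
      · have : d ≤ (m + 5) * d := Nat.le_mul_of_pos_left d (by omega)
        omega
      · refine Fin.cases ?_ h i
        rw [hk 0]
        simp [hp]

lemma mem_expSubgroup_iff {n m : ℕ} (w : Fin m → List (Fin n × Bool)) (y : Fin n → ℤ) :
    y ∈ expSubgroup w ↔ ∃ k : Fin m → ℤ, ∀ i, y i = ∑ j, k j * expVec (w j) i := by
  rw [expSubgroup, ← Submodule.span_int_eq_addSubgroupClosure, Submodule.mem_toAddSubgroup,
    Submodule.mem_span_range_iff_exists_fun]
  refine exists_congr fun k => ?_
  rw [eq_comm, funext_iff]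
  simp

end Coefficients

/-! ### Flows of encoded tuples of words in terms of positions -/

section Positions

open FreeGroup

variable {n m : ℕ}

/-- The exponent with which a generator occurs at a position of an encoded tuple. -/
def signAt (x : List (Option (Fin n × Bool))) (p : ℕ) (i : Fin n) : ℤ :=
  (if x[p]? = some (some (i, true)) then 1 else 0) - (if x[p]? = some (some (i, false)) then 1 else 0)

/-- The number of separators before a position. -/
def blockAt (x : List (Option (Fin n × Bool))) (p : ℕ) : ℕ :=
  ∑ q ∈ Finset.range p, if x[q]? = some none then 1 else 0

/-- The exponent sum vector of the prefix before a position. -/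
def prefixAt (x : List (Option (Fin n × Bool))) (p : ℕ) (i : Fin n) : ℤ :=
  ∑ q ∈ Finset.range p, signAt x q i

/-- The sum of a function of the block, the prefix and the letter over the letters of an encoded
tuple. -/
def scanSum {C : Type*} [AddCommMonoid C] (T : ℕ → (Fin n → ℤ) → Fin n × Bool → C) :
    ℕ → (Fin n → ℤ) → List (Option (Fin n × Bool)) → C
  | _, _, [] => 0
  | k, q, none :: x => scanSum T (k + 1) q x
  | k, q, some l :: x => T k q l + scanSum T k (q + letterVal (fun i => Pi.single i 1) l) x

/-- The sum of a function of the block, the prefix and the letter over the letters of one word. -/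
def wordSum {C : Type*} [AddCommMonoid C] (T : ℕ → (Fin n → ℤ) → Fin n × Bool → C) (k : ℕ) :
    (Fin n → ℤ) → List (Fin n × Bool) → C
  | _, [] => 0
  | q, l :: w => T k q l + wordSum T k (q + letterVal (fun i => Pi.single i 1) l) w

section Sums

variable {C : Type*} [AddCommMonoid C] (T : ℕ → (Fin n → ℤ) → Fin n × Bool → C)

lemma scanSum_append (k : ℕ) (q : Fin n → ℤ) (w : List (Fin n × Bool))
    (x : List (Option (Fin n × Bool))) : scanSum T k q (w.map some ++ none :: x) =
      wordSum T k q w + scanSum T (k + 1) (q + expVec w) x := by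
  induction w generalizing q with
  | nil => simp [scanSum, wordSum]
  | cons l w ih => simp [scanSum, wordSum, ih, add_assoc]

lemma encodeWordTuple_succ (w : Fin (m + 1) → List (Fin n × Bool)) :
    encodeWordTuple w = (w 0).map some ++ none :: encodeWordTuple fun j => w j.succ := by
  simp [encodeWordTuple, List.ofFn_succ]

/-- By `hw` the completed blocks do not affect later summands. This holds modulo `expSubgroup w`, so
prefixes can be taken over the whole encoding without resetting at separators. -/
lemma scanSum_encodeWordTuple (k : ℕ) (q : Fin n → ℤ) (w : Fin m → List (Fin n × Bool))
    (hw : ∀ i j k q, wordSum T k (q + expVec (w i)) (w j) = wordSum T k q (w j)) :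
    scanSum T k q (encodeWordTuple w) = ∑ j : Fin m, wordSum T (k + (j : ℕ)) q (w j) := by
  induction m generalizing k q with
  | zero => rfl
  | succ m ih =>
    rw [encodeWordTuple_succ, scanSum_append, ih _ _ _ fun i j => hw _ _, Fin.sum_univ_succ]
    congr 1
    refine Finset.sum_congr rfl fun j _ => ?_
    rw [hw, Fin.val_succ, add_right_comm, add_assoc]

lemma signAt_cons_succ (a : Option (Fin n × Bool)) (x : List (Option (Fin n × Bool))) (p : ℕ)
    (i : Fin n) : signAt (a :: x) (p + 1) i = signAt x p i := by
  simp [signAt]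

lemma signAt_none_cons (x : List (Option (Fin n × Bool))) (i : Fin n) :
    signAt (none :: x) 0 i = 0 := by
  simp [signAt]

lemma signAt_of_getElem? {x : List (Option (Fin n × Bool))} {p : ℕ} {l : Fin n × Bool}
    (h : x[p]? = some (some l)) (i : Fin n) :
    signAt x p i = letterVal (fun i => (Pi.single i 1 : Fin n → ℤ)) l i := by
  rcases l with ⟨k, _ | _⟩ <;> simp [signAt, h, letterVal, Pi.single_apply, eq_comm]

lemma blockAt_cons (a : Option (Fin n × Bool)) (x : List (Option (Fin n × Bool))) (p : ℕ) :
    blockAt (a :: x) (p + 1) = (if a = none then 1 else 0) + blockAt x p := by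
  rw [blockAt, Finset.sum_range_succ', add_comm]
  simp [blockAt]

lemma prefixAt_cons (a : Option (Fin n × Bool)) (x : List (Option (Fin n × Bool))) (p : ℕ) :
    prefixAt (a :: x) (p + 1) = signAt (a :: x) 0 + prefixAt x p := by
  funext i
  rw [prefixAt, Finset.sum_range_succ', add_comm]
  simp [prefixAt, signAt_cons_succ]

/-- The contribution of a position to the sum over the letters. -/
def termAt (k : ℕ) (q : Fin n → ℤ) (x : List (Option (Fin n × Bool))) (p : ℕ) : C :=
  match x[p]? with
  | some (some l) => T (k + blockAt x p) (q + prefixAt x p) l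
  | _ => 0

lemma scanSum_eq_sum (k : ℕ) (q : Fin n → ℤ) (x : List (Option (Fin n × Bool))) :
    scanSum T k q x = ∑ p ∈ Finset.range x.length, termAt T k q x p := by
  induction x generalizing k q with
  | nil => rfl
  | cons a x ih =>
    rw [List.length_cons, Finset.sum_range_succ']
    rcases a with _ | l
    · rw [scanSum, ih]
      have h0 : termAt T k q (none :: x) 0 = 0 := rfl
      rw [h0, add_zero]
      refine Finset.sum_congr rfl fun p _ => ?_
      have h1 : signAt (none :: x) 0 = 0 := funext (signAt_none_cons x)
      simp only [termAt, blockAt_cons, prefixAt_cons, List.getElem?_cons_succ, h1, if_true, zero_add,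
        add_assoc]
    · rw [scanSum, ih, add_comm]
      congr 1
      · refine Finset.sum_congr rfl fun p _ => ?_
        have h1 : signAt (some l :: x) 0 = letterVal (fun i => (Pi.single i 1 : Fin n → ℤ)) l :=
          funext (signAt_of_getElem? (by simp))
        simp only [termAt, blockAt_cons, prefixAt_cons, List.getElem?_cons_succ, h1, reduceCtorEq,
          if_false, zero_add, add_assoc]
      · have h2 : prefixAt (some l :: x) 0 = 0 := rfl
        simp [termAt, h2, blockAt]

end Sums

/-- The exponent sum of a generator in a block. -/
def blockExp (x : List (Option (Fin n × Bool))) (j : ℕ) (i : Fin n) : ℤ :=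
  ∑ p ∈ Finset.range x.length, if blockAt x p = j then signAt x p i else 0

lemma blockExp_encodeWordTuple (w : Fin m → List (Fin n × Bool)) (j : Fin m) (i : Fin n) :
    blockExp (encodeWordTuple w) j i = expVec (w j) i := by
  let T : ℕ → (Fin n → ℤ) → Fin n × Bool → ℤ := fun k _ l =>
    if k = j then letterVal (fun i => (Pi.single i 1 : Fin n → ℤ)) l i else 0
  have hT : ∀ k q v, wordSum T k q v = if k = j then expVec v i else 0 := by
    intro k q v
    induction v generalizing q with
    | nil => simp [wordSum]
    | cons l v ih =>
      rw [wordSum, ih]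
      split_ifs with h <;> simp [T, h]
  have h := scanSum_encodeWordTuple T 0 0 w fun _ _ _ _ => by rw [hT, hT]
  rw [scanSum_eq_sum] at h
  simp only [hT, zero_add, Fin.val_inj, Finset.sum_ite_eq', Finset.mem_univ, if_true] at h
  rw [← h, blockExp]
  refine Finset.sum_congr rfl fun p _ => ?_
  rw [termAt]
  rcases hx : (encodeWordTuple w)[p]? with _ | _ | l
  · simp [signAt, hx]
  · simp [signAt, hx]
  · simp only [T, zero_add, signAt_of_getElem? hx]

/-- The initial vertex of the edge at a position, when the blocks are translated by `V`. -/
def edgeAt (x : List (Option (Fin n × Bool))) (V : ℕ → Fin n → ℤ) (p : ℕ) (i : Fin n) : ℤ :=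
  prefixAt x p i + V (blockAt x p) i - if x[p]? = some (some (i, false)) then 1 else 0

open Classical in
theorem sum_flow_apply (w : Fin m → List (Fin n × Bool)) (V : ℕ → Fin n → ℤ) (i : Fin n)
    (e : (Fin n → ℤ) ⧸ expSubgroup w) :
    (∑ j : Fin m, flow (quotGen w) (QuotientAddGroup.mk (V j)) (w j)) (i, e) =
      ∑ p ∈ Finset.range (encodeWordTuple w).length, signAt (encodeWordTuple w) p i *
        if QuotientAddGroup.mk (edgeAt (encodeWordTuple w) V p) = e then 1 else 0 := by
  let T : ℕ → (Fin n → ℤ) → Fin n × Bool → (Fin n × ((Fin n → ℤ) ⧸ expSubgroup w) →₀ ℤ) :=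
    fun k q l => letterFlow (quotGen w) (QuotientAddGroup.mk (q + V k)) l
  have hT : ∀ k q v, wordSum T k q v = flow (quotGen w) (QuotientAddGroup.mk (q + V k)) v := by
    intro k q v
    induction v generalizing q with
    | nil => rfl
    | cons l v ih =>
      rw [wordSum, ih, flow_cons]
      congr 2
      rcases l with ⟨i, _ | _⟩ <;> simp [letterVal] <;> abel
  have hw : ∀ j, (QuotientAddGroup.mk (expVec (w j)) : (Fin n → ℤ) ⧸ expSubgroup w) = 0 := fun j =>
    (QuotientAddGroup.eq_zero_iff _).2 (AddSubgroup.subset_closure ⟨j, rfl⟩)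
  have h := scanSum_encodeWordTuple T 0 0 w fun i j k q => by
    rw [hT, hT, add_right_comm, QuotientAddGroup.mk_add, hw, add_zero]
  rw [scanSum_eq_sum] at h
  simp only [hT, zero_add] at h
  rw [← h, Finsupp.finsetSum_apply]
  refine Finset.sum_congr rfl fun p _ => ?_
  rw [termAt]
  rcases hx : (encodeWordTuple w)[p]? with _ | _ | l
  · simp [signAt, hx]
  · simp [signAt, hx]
  · simp only [T, zero_add, signAt_of_getElem? hx]
    have he : edgeAt (encodeWordTuple w) V p = prefixAt (encodeWordTuple w) p +
        V (blockAt (encodeWordTuple w) p) - if l.2 then 0 else Pi.single l.1 1 := by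
      funext k
      rcases l with ⟨j, _ | _⟩ <;> simp [edgeAt, hx, Pi.single_apply, eq_comm]
    rw [he]
    rcases l with ⟨k, _ | _⟩
    · by_cases hk : k = i
      · subst hk
        have hg : quotGen w k = QuotientAddGroup.mk (Pi.single k 1) := rfl
        simp only [letterFlow, letterVal, hg]
        split_ifs <;> simp_all
      · simp [letterFlow, letterVal, Ne.symm hk]
    · by_cases hk : k = i
      · subst hk
        simp [letterFlow, letterVal, Finsupp.single_apply]
      · simp [letterFlow, letterVal, Ne.symm hk]

-- A combined flow vanishes at every vertex not met by a traversed edge, so it suffices to test the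
-- initial vertices occurring at the positions `p₀`.
open Classical in
theorem sum_flow_eq_zero_iff (w : Fin m → List (Fin n × Bool)) (V : ℕ → Fin n → ℤ) :
    ∑ j : Fin m, flow (quotGen w) (QuotientAddGroup.mk (V j)) (w j) = 0 ↔
      ∀ i, ∀ p₀ < (encodeWordTuple w).length, ∑ p ∈ Finset.range (encodeWordTuple w).length,
        signAt (encodeWordTuple w) p i * (if edgeAt (encodeWordTuple w) V p -
          edgeAt (encodeWordTuple w) V p₀ ∈ expSubgroup w then 1 else 0) = 0 := by
  have hq : ∀ a b : Fin n → ℤ, (QuotientAddGroup.mk a : (Fin n → ℤ) ⧸ expSubgroup w) =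
      QuotientAddGroup.mk b ↔ a - b ∈ expSubgroup w := fun a b => by
    rw [← sub_eq_zero, ← QuotientAddGroup.mk_sub, QuotientAddGroup.eq_zero_iff]
  constructor
  · intro h i p₀ _
    have := DFunLike.congr_fun h (i, QuotientAddGroup.mk (edgeAt (encodeWordTuple w) V p₀))
    rw [sum_flow_apply, Finsupp.zero_apply] at this
    simpa only [hq] using this
  · intro h
    ext ⟨i, e⟩
    rw [sum_flow_apply, Finsupp.zero_apply]
    by_cases he : ∃ p₀ < (encodeWordTuple w).length,
        QuotientAddGroup.mk (edgeAt (encodeWordTuple w) V p₀) = e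
    · obtain ⟨p₀, hp₀, rfl⟩ := he
      simpa only [hq] using h i p₀ hp₀
    · push Not at he
      refine Finset.sum_eq_zero fun p hp => ?_
      rw [if_neg (he p (Finset.mem_range.1 hp)), mul_zero]

lemma encodeWordTuple_length_le (w : Fin m → List (Fin n × Bool)) (j : Fin m) :
    (w j).length ≤ (encodeWordTuple w).length := by
  rw [encodeWordTuple, List.length_flatten, List.map_ofFn, List.sum_ofFn]
  refine le_trans ?_ (Finset.single_le_sum (fun _ _ => Nat.zero_le _) (Finset.mem_univ j))
  simp

/-- Recognition of the encodings of tuples of words. -/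
theorem exists_eq_encodeWordTuple_iff (x : List (Option (Fin n × Bool))) :
    (∃ w : Fin m → List (Fin n × Bool), x = encodeWordTuple w) ↔
      blockAt x x.length = m ∧ ∀ p < x.length, p + 1 = x.length → x[p]? = some none := by
  have key : ∀ k : ℕ, ∀ x : List (Option (Fin n × Bool)),
      (∃ w : Fin k → List (Fin n × Bool), x = encodeWordTuple w) ↔
        blockAt x x.length = k ∧ ∀ p < x.length, p + 1 = x.length → x[p]? = some none := by
    intro k x
    induction x generalizing k with
    | nil =>
      cases k with
      | zero => simp [encodeWordTuple, blockAt]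
      | succ k =>
        simp only [encodeWordTuple_succ]
        simp [blockAt]
    | cons a x ih =>
      have hlast : (∀ p < (a :: x).length, p + 1 = (a :: x).length → (a :: x)[p]? = some none) ↔
          (∀ p < x.length, p + 1 = x.length → x[p]? = some none) ∧ (x = [] → a = none) := by
        constructor
        · refine fun h => ⟨fun p hp hp' => by simpa using h (p + 1) (by simpa) (by simpa), ?_⟩
          rintro rfl
          simpa using h 0 (by simp) (by simp)
        · rintro ⟨h, h'⟩ p hp hp'
          rcases p with _ | p
          · have : x = [] := List.eq_nil_of_length_eq_zero (by simpa using hp'.symm)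
            simp [h' this]
          · simpa using h p (by simpa using hp) (by simpa using hp')
      rw [hlast, List.length_cons, blockAt_cons]
      rcases a with _ | l
      · cases k with
        | zero => simp [encodeWordTuple]
        | succ k =>
          have : (∃ w : Fin (k + 1) → List (Fin n × Bool), none :: x = encodeWordTuple w) ↔
              ∃ w : Fin k → List (Fin n × Bool), x = encodeWordTuple w := by
            constructor
            · rintro ⟨w, hw⟩
              rw [encodeWordTuple_succ] at hw
              rcases h0 : w 0 with _ | ⟨l, v⟩
              · exact ⟨_, by simpa [h0] using hw⟩
              · simp [h0] at hw
            · rintro ⟨w, rfl⟩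
              exact ⟨Fin.cons [] w, by rw [encodeWordTuple_succ]; simp⟩
          rw [this, ih]
          simp [add_comm 1]
      · have : (∃ w : Fin k → List (Fin n × Bool), some l :: x = encodeWordTuple w) ↔
              k ≠ 0 ∧ ∃ w : Fin k → List (Fin n × Bool), x = encodeWordTuple w := by
          cases k with
          | zero => simp [encodeWordTuple]
          | succ k =>
            constructor
            · rintro ⟨w, hw⟩
              rw [encodeWordTuple_succ] at hw
              rcases h0 : w 0 with _ | ⟨l, v⟩
              · simp [h0] at hw
              · refine ⟨by simp, Fin.cons v fun j => w j.succ, ?_⟩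
                rw [encodeWordTuple_succ]
                simp only [h0, List.map_cons, List.cons_append, List.cons.injEq] at hw
                simpa using hw.2
            · rintro ⟨-, w, rfl⟩
              refine ⟨Fin.cons (l :: w 0) fun j => w j.succ, ?_⟩
              rw [encodeWordTuple_succ, encodeWordTuple_succ]
              simp
        rw [this, ih]
        have hx : x = [] → blockAt x x.length = 0 := by rintro rfl; rfl
        constructor
        · rintro ⟨h, rfl, h'⟩
          refine ⟨by simp, h', fun h0 => absurd (hx h0) h⟩
        · rintro ⟨h, h', h''⟩
          simp only [reduceCtorEq, if_false, zero_add] at h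
          refine ⟨?_, h, h'⟩
          rintro rfl
          have hne : x ≠ [] := fun h0 => by simpa using h'' h0
          have hlen : 0 < x.length := List.length_pos_iff.2 hne
          -- A nonempty remainder ends with a separator, so its block count cannot be zero.
          have h1 := h' (x.length - 1) (by omega) (by omega)
          rw [blockAt, Finset.sum_eq_zero_iff] at h
          have := h (x.length - 1) (Finset.mem_range.2 (by omega))
          simp [h1] at this
  exact key m x

end Positions

/-! ### Reduction to bounded searches -/

section Search

open FreeGroup

variable {n m : ℕ}

/-- The translation vectors of the blocks that are coded by the digits of a number in base `b`. -/
def translation (n m b D k : ℕ) (i : Fin n) : ℤ :=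
  ∑ j : Fin m, if k = j then ((D / b ^ (finProdFinEquiv (j, i) : ℕ) % b : ℕ) : ℤ) else 0

lemma translation_apply (b D : ℕ) (j : Fin m) (i : Fin n) :
    translation n m b D j i = (D / b ^ (finProdFinEquiv (j, i) : ℕ) % b : ℕ) := by
  simp [translation, Fin.val_inj]

lemma abs_translation_le {b : ℕ} (hb : 0 < b) (D k : ℕ) (i : Fin n) :
    |translation n m b D k i| ≤ b := by
  by_cases hk : k < m
  · rw [translation_apply b D ⟨k, hk⟩ i, Nat.abs_cast, Nat.cast_le]
    exact (Nat.mod_lt _ hb).le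
  · rw [translation, Finset.sum_eq_zero fun (j : Fin m) _ => if_neg fun h : k = (j : ℕ) => hk (h.symm ▸ j.2)]
    simp

lemma exists_digits {b k : ℕ} (v : Fin k → ℕ) (hv : ∀ i, v i < b) :
    ∃ D < b ^ k, ∀ i : Fin k, D / b ^ (i : ℕ) % b = v i := by
  refine ⟨finFunctionFinEquiv fun i => ⟨v i, hv i⟩, Fin.is_lt _, fun i => ?_⟩
  have := congrFun (finFunctionFinEquiv.symm_apply_apply fun i => (⟨v i, hv i⟩ : Fin b)) i
  exact congrArg Fin.val this

/-- Membership in the subgroup generated by the exponent sum vectors is a bounded search. -/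
theorem mem_expSubgroup_iff_exists_digits (n m : ℕ) : ∃ d : ℕ, ∀ L : ℕ, 2 ≤ L →
    ∀ w : Fin m → List (Fin n × Bool), (∀ j i, |expVec (w j) i| ≤ L) →
    ∀ y : Fin n → ℤ, (∀ i, |y i| ≤ L) → (y ∈ expSubgroup w ↔ ∃ K < (2 * L ^ d + 1) ^ m, ∀ i, y i =
      ∑ j : Fin m, (((K / (2 * L ^ d + 1) ^ (j : ℕ) % (2 * L ^ d + 1) : ℕ) : ℤ) - (L ^ d : ℕ)) *
        expVec (w j) i) := by
  obtain ⟨d, hd⟩ := exists_bounded_coefficients n m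
  refine ⟨d, fun L hL w hw y hy => ?_⟩
  rw [mem_expSubgroup_iff]
  refine ⟨fun h => ?_, fun ⟨K, _, hK⟩ => ⟨_, hK⟩⟩
  obtain ⟨k, hk, hky⟩ := hd L (by exact_mod_cast hL) _ y hw hy h
  -- Coefficients between `-L ^ d` and `L ^ d` become digits in base `2 * L ^ d + 1` after adding `L
  -- ^ d`.
  obtain ⟨K, hK, hdig⟩ := exists_digits (b := 2 * L ^ d + 1) (fun j => (k j + L ^ d).toNat) fun j => by
    have := abs_le.1 (hk j)
    zify at this ⊢
    rw [Int.toNat_of_nonneg (by linarith)]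
    linarith
  refine ⟨K, hK, fun i => (hky i).trans (Finset.sum_congr rfl fun j _ => ?_)⟩
  have := abs_le.1 (hk j)
  rw [hdig, Int.toNat_of_nonneg (by linarith)]
  push_cast
  ring

lemma abs_signAt_le (x : List (Option (Fin n × Bool))) (p : ℕ) (i : Fin n) : |signAt x p i| ≤ 1 := by
  rw [signAt]
  split_ifs <;> simp

lemma abs_prefixAt_le (x : List (Option (Fin n × Bool))) (p : ℕ) (i : Fin n) :
    |prefixAt x p i| ≤ p := by
  refine (Finset.abs_sum_le_sum_abs _ _).trans ?_
  refine (Finset.sum_le_sum fun q _ => abs_signAt_le x q i).trans ?_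
  simp

lemma abs_blockExp_le (x : List (Option (Fin n × Bool))) (j : ℕ) (i : Fin n) :
    |blockExp x j i| ≤ x.length := by
  refine (Finset.abs_sum_le_sum_abs _ _).trans ?_
  refine (Finset.sum_le_sum (g := fun _ => (1 : ℤ)) fun q _ => ?_).trans (by simp)
  split_ifs
  · exact abs_signAt_le x q i
  · simp

lemma abs_edgeAt_le {x : List (Option (Fin n × Bool))} {V : ℕ → Fin n → ℤ} {B : ℤ}
    (hV : ∀ k i, |V k i| ≤ B) {p : ℕ} (hp : p < x.length) (i : Fin n) :
    |edgeAt x V p i| ≤ x.length + B + 1 := by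
  have h₁ := abs_le.1 (abs_prefixAt_le x p i)
  have h₂ := abs_le.1 (hV (blockAt x p) i)
  have h₃ : (p : ℤ) ≤ x.length := by exact_mod_cast hp.le
  rw [abs_le, edgeAt]
  constructor <;> split_ifs <;> linarith [h₁.1, h₁.2, h₂.1, h₂.2]

/-- The difference of two edges is an integral combination of the exponent sum vectors, with
coefficients that are coded by a number in base `2 * N + 1`. -/
def EdgesAgree (m N : ℕ) (x : List (Option (Fin n × Bool))) (V : ℕ → Fin n → ℤ) (p₀ p : ℕ) : Prop :=
  ∃ K < (2 * N + 1) ^ m, ∀ i, edgeAt x V p i - edgeAt x V p₀ i =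
    ∑ j : Fin m, (((K / (2 * N + 1) ^ (j : ℕ) % (2 * N + 1) : ℕ) : ℤ) - N) * blockExp x j i

/-- The base for the digits of translation vectors. -/
def digitBase (m l : ℕ) : ℕ := 4 * m * l + 1

open Classical in
/-- The translations coded by `D` make the sum of the flows vanish. -/
def FlowsCancel (m N : ℕ) (x : List (Option (Fin n × Bool))) (D : ℕ) : Prop :=
  ∀ i : Fin n, ∀ p₀ < x.length, ∑ p ∈ Finset.range x.length, signAt x p i *
    (if EdgesAgree m N x (translation n m (digitBase m x.length) D) p₀ p then 1 else 0) = 0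

/-- The Diophantine problem is a bounded search. -/
theorem equationHasSolution_iff_exists_flowsCancel (n m : ℕ) : ∃ d : ℕ,
    ∀ w : Fin m → List (Fin n × Bool),
      EquationHasSolution (sphericalWord fun i => FreeMetabelianGroup.ofWord (w i)) ↔
        ∃ D < digitBase m (encodeWordTuple w).length ^ (m * n),
          FlowsCancel m (((8 * m + 4) * ((encodeWordTuple w).length + 1)) ^ d)
            (encodeWordTuple w) D := by
  obtain ⟨d, hd⟩ := mem_expSubgroup_iff_exists_digits n m
  refine ⟨d, fun w => ?_⟩
  rw [equationHasSolution_iff_exists_flow, exists_flow_iff_exists_bounded w _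
    (encodeWordTuple_length_le w)]
  set x := encodeWordTuple w with hx
  have hb : 0 < digitBase m x.length := Nat.succ_pos _
  have key : ∀ D, FlowsCancel m (((8 * m + 4) * (x.length + 1)) ^ d) x D ↔ ∑ j : Fin m,
      flow (quotGen w) (QuotientAddGroup.mk (translation n m (digitBase m x.length) D j)) (w j) = 0 := by
    intro D
    rw [sum_flow_eq_zero_iff, ← hx, FlowsCancel]
    refine forall_congr' fun i => forall₂_congr fun p₀ hp₀ => Eq.congr_left ?_
    refine Finset.sum_congr rfl fun p hp => ?_
    rw [Finset.mem_range] at hp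
    congr 2
    rw [eq_iff_iff, EdgesAgree, hd ((8 * m + 4) * (x.length + 1)) (by nlinarith) w ?_ _ ?_]
    · simp only [hx, blockExp_encodeWordTuple, Pi.sub_apply]
    · intro j i
      rw [← blockExp_encodeWordTuple, ← hx]
      refine (abs_blockExp_le _ _ _).trans ?_
      norm_cast
      nlinarith
    · intro i
      have hV : ∀ k i, |translation n m (digitBase m x.length) D k i| ≤ digitBase m x.length :=
        fun k i => abs_translation_le hb D k i
      have h₁ := abs_edgeAt_le hV hp i
      have h₂ := abs_edgeAt_le hV hp₀ i
      -- With `l` the input length, each edge is bounded by `l + (4 m l + 1) + 1`, so the difference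
      -- is at most `8 m l + 2 l + 4 ≤ (8 m + 4) (l + 1)`.
      refine (abs_sub _ _).trans ((add_le_add h₁ h₂).trans ?_)
      rw [digitBase]
      push_cast
      nlinarith
  simp only [key]
  constructor
  · rintro ⟨v, hv, h⟩
    obtain ⟨D, hD, hdig⟩ := exists_digits (b := digitBase m x.length)
      (fun l => v (finProdFinEquiv.symm l).1 (finProdFinEquiv.symm l).2) fun l =>
        -- The box bound `2 * (m * (2 * l))` equals `4 m l`, the largest digit in base `digitBase m
        -- l`.
        (hv _ _).trans_lt (by rw [digitBase, Nat.lt_succ_iff]; exact le_of_eq (by ring))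
    refine ⟨D, hD, ?_⟩
    convert h using 5
    rw [translation_apply, hdig, Equiv.symm_apply_apply]
  · rintro ⟨D, -, h⟩
    refine ⟨fun j i => D / digitBase m x.length ^ (finProdFinEquiv (j, i) : ℕ) %
      digitBase m x.length, fun j i => ?_, ?_⟩
    · have := Nat.mod_lt (D / digitBase m x.length ^ (finProdFinEquiv (j, i) : ℕ)) hb
      rw [digitBase] at this ⊢
      calc _ ≤ 4 * m * x.length := Nat.lt_succ_iff.1 this
        _ = _ := by ring
    · convert h using 5
      rw [translation_apply]

end Search

/-! ### The complexity of the search -/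

namespace RegProgram

open Context

variable {n m : ℕ} {α : Type} [Context (Option (Fin n × Bool)) α] {f g : α → ℕ}

lemma PolyComputableInt.signAt (hf : PolyComputable f) (i : Fin n) :
    PolyComputableInt fun a => signAt (word a) (f a) i :=
  (ite (.getElem?_word _ hf) (const 1) (const 0)).sub (ite (.getElem?_word _ hf) (const 1) (const 0))

lemma PolyComputable.blockAt (hf : PolyComputable f) :
    PolyComputable fun a => blockAt (word a) (f a) :=
  hf.sum (g := fun a q => if (word a)[q]? = some none then 1 else 0)
    (PolyDecidable.getElem?_word none snd).indicator

lemma PolyComputableInt.prefixAt (hf : PolyComputable f) (i : Fin n) :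
    PolyComputableInt fun a => prefixAt (word a) (f a) i :=
  sum hf (g := fun a q => _root_.signAt (word a) q i) (signAt .snd i)

lemma PolyComputableInt.blockExp (j : ℕ) (i : Fin n) :
    PolyComputableInt fun a : α => blockExp (word a) j i :=
  sum .length_word (g := fun a p => if _root_.blockAt (word a) p = j then _root_.signAt (word a) p i else 0)
    (ite (.eq (.blockAt .snd) (.const j)) (signAt .snd i) (const 0))

lemma PolyComputableInt.translation {b D k : α → ℕ} (hb : PolyComputable b) (hD : PolyComputable D)
    (hk : PolyComputable k) (i : Fin n) :
    PolyComputableInt fun a => translation n m (b a) (D a) (k a) i :=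
  finset_sum _ fun j => ite (.eq hk (.const j)) (natCast ((hD.div (hb.pow _)).mod hb)) (const 0)

lemma PolyComputableInt.edgeAt {V : α → ℕ → Fin n → ℤ} (hf : PolyComputable f) (i : Fin n)
    (hV : PolyComputableInt fun a => V a (_root_.blockAt (word a) (f a)) i) :
    PolyComputableInt fun a => edgeAt (word a) (V a) (f a) i :=
  ((prefixAt hf i).add hV).sub (ite (.getElem?_word _ hf) (const 1) (const 0))

lemma PolyDecidable.edgesAgree {V : α → ℕ → Fin n → ℤ} {N : α → ℕ} (hN : PolyComputable N)
    (hf : PolyComputable f) (hg : PolyComputable g)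
    (hVf : ∀ i, PolyComputableInt fun a => V a (_root_.blockAt (word a) (f a)) i)
    (hVg : ∀ i, PolyComputableInt fun a => V a (_root_.blockAt (word a) (g a)) i) :
    PolyDecidable fun a => EdgesAgree m (N a) (word a) (V a) (f a) (g a) := by
  have hM : PolyComputable fun a => 2 * N a + 1 := (PolyComputable.mul (.const 2) hN).add .one
  exact exists_lt (P := fun a K => ∀ i, _root_.edgeAt (word a) (V a) (g a) i -
      _root_.edgeAt (word a) (V a) (f a) i = ∑ j : Fin m,
        (((K / (2 * N a + 1) ^ (j : ℕ) % (2 * N a + 1) : ℕ) : ℤ) - N a) *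
          _root_.blockExp (word a) j i) (hM.pow m) <| forall_fintype fun i =>
    PolyComputableInt.eq (((PolyComputableInt.edgeAt hg i (hVg i)).sub (.edgeAt hf i (hVf i))).lift) <|
      .finset_sum _ fun j => .mul (.sub (.natCast
        ((PolyComputable.snd.div (hM.lift.pow _)).mod hM.lift)) (.natCast hN.lift)) (.blockExp j i)

lemma PolyDecidable.flowsCancel {N D : α → ℕ} (hN : PolyComputable N) (hD : PolyComputable D) :
    PolyDecidable fun a => FlowsCancel m (N a) (word a) (D a) := by
  classical
  have hb : PolyComputable fun a : α => digitBase m (word a).length :=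
    (PolyComputable.mul (.const _) .length_word).add .one
  refine forall_fintype fun i => forall_lt (P := fun a p₀ => ∑ p ∈ Finset.range (word a).length,
    _root_.signAt (word a) p i * (if EdgesAgree m (N a) (word a)
      (_root_.translation n m (digitBase m (word a).length) (D a)) p₀ p then 1 else 0) = 0)
    .length_word (PolyComputableInt.eq (.sum (g := fun (b : α × ℕ) p => _root_.signAt (word b) p i * (if EdgesAgree m (N b.1)
      (word b) (_root_.translation n m (digitBase m (word b).length) (D b.1)) b.2 p then 1 else 0))
        .length_word ?_) (.const 0))
  -- The positions `p₀` and `p` are two numbers adjoined to the context, hence the double `lift`.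
  refine .mul (.signAt .snd i) (.ite (edgesAgree hN.lift.lift PolyComputable.snd.lift .snd ?_ ?_)
    (.const 1) (.const 0))
  · exact fun i => .translation hb.lift.lift hD.lift.lift (.blockAt PolyComputable.snd.lift) i
  · exact fun i => .translation hb.lift.lift hD.lift.lift (.blockAt .snd) i

end RegProgram

open RegProgram in
theorem mainTheorem4 (n m : ℕ) : IsInP (sphericalDiophantineLanguage n m) := by
  classical
  obtain ⟨d, hd⟩ := equationHasSolution_iff_exists_flowsCancel n m
  have hmem : ∀ x : List (Option (Fin n × Bool)), x ∈ sphericalDiophantineLanguage n m ↔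
      (blockAt x x.length = m ∧ ∀ p < x.length, p + 1 = x.length → x[p]? = some none) ∧
        ∃ D < digitBase m x.length ^ (m * n),
          FlowsCancel m (((8 * m + 4) * (x.length + 1)) ^ d) x D := by
    intro x
    rw [← exists_eq_encodeWordTuple_iff]
    constructor
    · rintro ⟨w, rfl, h⟩
      exact ⟨⟨w, rfl⟩, (hd w).1 h⟩
    · rintro ⟨⟨w, rfl⟩, h⟩
      exact ⟨w, rfl, (hd w).2 h⟩
  have hl : PolyComputable fun x : List (Option (Fin n × Bool)) => x.length := .length_word
  have hb : PolyComputable fun x : List (Option (Fin n × Bool)) => digitBase m x.length :=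
    (PolyComputable.mul (.const (4 * m)) hl).add .one
  have hN : PolyComputable fun x : List (Option (Fin n × Bool)) =>
      ((8 * m + 4) * (x.length + 1)) ^ d :=
    (PolyComputable.mul (.const (8 * m + 4)) (hl.add .one)).pow d
  have hcount : PolyDecidable fun x : List (Option (Fin n × Bool)) => blockAt x x.length = m :=
    .eq (PolyComputable.blockAt hl) (.const m)
  have hlast : PolyDecidable fun x : List (Option (Fin n × Bool)) =>
      ∀ p < x.length, p + 1 = x.length → x[p]? = some none :=
    .forall_lt (P := fun x p => p + 1 = x.length → x[p]? = some none) hl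
      (.imp (.eq (PolyComputable.snd.add .one) hl.lift) (.getElem?_word none .snd))
  have hcancel : PolyDecidable fun b : List (Option (Fin n × Bool)) × ℕ =>
      FlowsCancel m (((8 * m + 4) * (b.1.length + 1)) ^ d) b.1 b.2 := .flowsCancel hN.lift .snd
  have hsearch : PolyDecidable fun x : List (Option (Fin n × Bool)) =>
      ∃ D < digitBase m x.length ^ (m * n),
        FlowsCancel m (((8 * m + 4) * (x.length + 1)) ^ d) x D :=
    -- The exponent `m * n` is constant, so the number of candidate translations is polynomial in
    -- the length.
    PolyDecidable.exists_lt (f := fun x => digitBase m x.length ^ (m * n))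
      (P := fun x D => FlowsCancel m (((8 * m + 4) * (x.length + 1)) ^ d) x D)
      (hb.pow (m * n)) hcancel
  have hdec : PolyDecidable fun x => x ∈ sphericalDiophantineLanguage n m :=
    ((hcount.and hlast).and hsearch).congr fun x => (hmem x).symm
  exact isInP_of_polyComputable _ hdec.indicator fun x => ⟨fun h => if_pos h, fun h => if_neg h⟩
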